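/- Let $d\ge 1$ and $N,K\ge 0$ be integers. For $M\ge 0$ let $\mathrm{sym}^M(\mathbb C^d)\subseteq(\mathbb C^d)^{\otimes M}$ be the symmetric subspace (the vectors invariant under all permutations of the tensor factors), $\Pi^{(M)}_{\mathrm{sym}}$ the orthogonal projector onto it, and $d_S^M:=\dim \mathrm{sym}^M(\mathbb C^d)=\binom{M+d-1}{d-1}$. Transposes are taken in the computational basis. For a density operator $\rho$ and a pure state $\phi$ put $F(\rho,\phi)=\mathrm{Tr}(\rho\,\phi)$, and for a channel, i.e. a completely positive trace-preserving linear map, $\mathcal C:\mathcal L(\mathrm{sym}^N(\mathbb C^d))\to\mathcal L(\mathbb C^d)^{\otimes K}$, and a unit vector $\psi\in\mathbb C^d$ put $$f_{\mathcal C}(\psi)=F\big(\mathcal C(|\psi\rangle\langle\psi|^{\otimes N}),\,(|\psi\rangle\langle\psi|^{\mathsf T})^{\otimes K}\big).$$ Then the minimum of $f_{\mathcal C}$ over all unit vectors $\psi$ is attained for every such channel $\mathcal C$, and $$\max_{\mathcal C}\ \min_{\psi}\ f_{\mathcal C}(\psi)=\frac{d_S^N}{d_S^{N+K}},$$ where the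 maximum is over all channels $\mathcal C:\mathcal L(\mathrm{sym}^N(\mathbb C^d))\to\mathcal L(\mathbb C^d)^{\otimes K}$ (no covariance is assumed). The maximum is attained by exactly one channel, the estimation channel $$\mathcal T_{\mathrm{CP}}(\rho)=d_S^N\int \mathrm d\psi\ \mathrm{Tr}\big(\rho\,|\psi\rangle\langle\psi|^{\otimes N}\big)\,(|\psi\rangle\langle\psi|^{\mathsf T})^{\otimes K}=\frac{d_S^N}{d_S^{N+K}}\,\mathrm{Tr}_{1\ldots N}\Big[\Pi^{(N+K)}_{\mathrm{sym}}\,\big(\rho^{\mathsf T}\otimes \mathbb 1^{\otimes K}\big)\Big],$$ where $\mathrm d\psi$ is the unitarily invariant probability measure on unit vectors, $\mathrm{Tr}_{1\ldots N}$ is the partial trace over the first $N$ factors, and in the last expression $\rho$ is extended by $0$ on the orthogonal complement of $\mathrm{sym}^N(\mathbb C^d)$. Its fidelity is constant, $f_{\mathcal T_{\mathrm{CP}}}(\psi)=d_S^N/d_S^{N+K}$ for every unit vector $\psi$, and its Choi operator $\sum_{i,j}|i\rangle\langle j|\otimes\mathcal T_{\mathrm{CP}}\big(\Pi^{(N)}_{\mathrm{sym}}|i\rangle\langle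 j|\Pi^{(N)}_{\mathrm{sym}}\big)$, the sum being over the computational basis of $(\mathbb C^d)^{\otimes N}$, equals $\frac{d_S^N}{d_S^{N+K}}\,\Pi^{(N+K)}_{\mathrm{sym}}$. -/

import Mathlib

open MeasureTheory

noncomputable section

namespace QTranspose

/-- The Hilbert space `(ℂ^d)^{⊗ M}`, in coordinates with respect to the computational product
basis `|i₁⟩ ⊗ ⋯ ⊗ |i_M⟩`, which is orthonormal and indexed by `i : Fin M → Fin d`. -/
abbrev TensorPow (d M : ℕ) : Type := EuclideanSpace ℂ (Fin M → Fin d)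

/-- `L(H)`, the linear operators on a (finite-dimensional) Hilbert space `H`. -/
abbrev Op (H : Type) [NormedAddCommGroup H] [InnerProductSpace ℂ H] : Type := H →L[ℂ] H

/-- The trace of an operator. -/
def tr {H : Type} [NormedAddCommGroup H] [InnerProductSpace ℂ H] (A : Op H) : ℂ :=
  LinearMap.trace ℂ H (A : H →ₗ[ℂ] H)

/-- The operator `|v⟩⟨w|`. -/
def ketbra {H : Type} [NormedAddCommGroup H] [InnerProductSpace ℂ H] (v w : H) : Op H :=
  InnerProductSpace.rankOne ℂ v w

section Coordinates

variable {ι : Type} [Fintype ι] [DecidableEq ι]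

/-- The operator on `ℂ^ι` with a given matrix in the computational basis. -/
def ofMat (A : Matrix ι ι ℂ) : Op (EuclideanSpace ℂ ι) :=
  Matrix.toEuclideanCLM (𝕜 := ℂ) (n := ι) A

/-- The matrix of an operator on `ℂ^ι` in the computational basis. -/
def mat (A : Op (EuclideanSpace ℂ ι)) : Matrix ι ι ℂ :=
  (Matrix.toEuclideanCLM (𝕜 := ℂ) (n := ι)).symm A

/-- The transpose of an operator in the computational basis. -/
def transposeOp (A : Op (EuclideanSpace ℂ ι)) : Op (EuclideanSpace ℂ ι) :=
  ofMat (mat A).transpose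

/-- The computational basis vector `|i⟩`. -/
def ket (i : ι) : EuclideanSpace ℂ ι := EuclideanSpace.single i 1

end Coordinates

/-- The product vector `ψ^{⊗ M}`. -/
def vecPow {d : ℕ} (ψ : EuclideanSpace ℂ (Fin d)) (M : ℕ) : TensorPow d M :=
  WithLp.toLp 2 fun i => ∏ m, ψ (i m)

/-- The operator `A^{⊗ M}`. -/
def opPow {d : ℕ} (A : Op (EuclideanSpace ℂ (Fin d))) (M : ℕ) : Op (TensorPow d M) :=
  ofMat (Matrix.of fun i j => ∏ m, mat A (i m) (j m))

/-- The operator `A ⊗ B` on `(ℂ^d)^{⊗ (N+K)}`; `A` acts on the first `N` factors and `B` on the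
last `K` factors. -/
def tensorOp {d N K : ℕ} (A : Op (TensorPow d N)) (B : Op (TensorPow d K)) :
    Op (TensorPow d (N + K)) :=
  ofMat (Matrix.of fun x y =>
    mat A (fun n => x (Fin.castAdd K n)) (fun n => y (Fin.castAdd K n)) *
      mat B (fun k => x (Fin.natAdd N k)) (fun k => y (Fin.natAdd N k)))

/-- The partial trace `Tr_{1…N}` over the first `N` of `N + K` factors. -/
def partialTraceFirst {d N K : ℕ} (A : Op (TensorPow d (N + K))) : Op (TensorPow d K) :=
  ofMat (Matrix.of fun a b => ∑ i : Fin N → Fin d, mat A (Fin.append i a) (Fin.append i b))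

/-- The symmetric subspace `sym^M(ℂ^d)` of `(ℂ^d)^{⊗ M}`: the vectors that are invariant under all
permutations of the tensor factors. -/
def symSubspace (d M : ℕ) : Submodule ℂ (TensorPow d M) where
  carrier := {v | ∀ (σ : Equiv.Perm (Fin M)) (i : Fin M → Fin d), v (fun m => i (σ m)) = v i}
  add_mem' := fun {v w} hv hw σ i => by
    simp only [PiLp.add_apply, hv σ i, hw σ i]
  zero_mem' := fun σ i => rfl
  smul_mem' := fun c v hv σ i => by
    simp only [PiLp.smul_apply, hv σ i]

instance instCompleteSpaceSym (d M : ℕ) : CompleteSpace (symSubspace d M) :=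
  FiniteDimensional.complete ℂ _

/-- `d_S^M`, the dimension of `sym^M(ℂ^d)`. -/
def symDim (d M : ℕ) : ℕ := Module.finrank ℂ (symSubspace d M)

/-- `Π_sym^{(M)}`, the orthogonal projector of `(ℂ^d)^{⊗ M}` onto `sym^M(ℂ^d)`. -/
def symProj (d M : ℕ) : Op (TensorPow d M) := (symSubspace d M).starProjection

theorem vecPow_mem {d : ℕ} (ψ : EuclideanSpace ℂ (Fin d)) (M : ℕ) :
    vecPow ψ M ∈ symSubspace d M := fun σ i =>
  Equiv.prod_comp σ fun m => ψ (i m)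

/-- The product vector `ψ^{⊗ M}` as an element of `sym^M(ℂ^d)`. -/
def symPow {d : ℕ} (ψ : EuclideanSpace ℂ (Fin d)) (M : ℕ) : symSubspace d M :=
  ⟨vecPow ψ M, vecPow_mem ψ M⟩

/-- An operator on `sym^M(ℂ^d)`, regarded as an operator on `(ℂ^d)^{⊗ M}` that vanishes on the
orthogonal complement of the symmetric subspace. -/
def extendOp {d M : ℕ} (ρ : Op (symSubspace d M)) : Op (TensorPow d M) :=
  (symSubspace d M).subtypeL ∘L ρ ∘L (symSubspace d M).orthogonalProjectionOnto

/-- The compression to `sym^M(ℂ^d)` of an operator on `(ℂ^d)^{⊗ M}`. -/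
def compressOp {d M : ℕ} (A : Op (TensorPow d M)) : Op (symSubspace d M) :=
  (symSubspace d M).orthogonalProjectionOnto ∘L A ∘L (symSubspace d M).subtypeL

/-- A quantum channel `L(H₁) → L(H₂)`: a completely positive and trace-preserving linear map. -/
structure Channel (H₁ H₂ : Type) [NormedAddCommGroup H₁] [InnerProductSpace ℂ H₁]
    [CompleteSpace H₁] [NormedAddCommGroup H₂] [InnerProductSpace ℂ H₂] [CompleteSpace H₂]
    extends CompletelyPositiveMap (Op H₁) (Op H₂) where
  trace_preserving : ∀ ρ : Op H₁, tr (toFun ρ) = tr ρ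

/-- The channels `L(sym^N(ℂ^d)) → L(ℂ^d)^{⊗ K}`. -/
abbrev SymChannel (d N K : ℕ) : Type := Channel (symSubspace d N) (TensorPow d K)

/-- The value `C(ρ)` of a channel. -/
def SymChannel.app {d N K : ℕ} (C : SymChannel d N K) (ρ : Op (symSubspace d N)) :
    Op (TensorPow d K) :=
  C.toFun ρ

/-- The fidelity `F(ρ, φ) = Tr(ρ φ)` of a state `ρ` with a pure state `φ` (for states, the trace is
real). -/
def fidelity {H : Type} [NormedAddCommGroup H] [InnerProductSpace ℂ H] (ρ φ : Op H) : ℝ :=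
  (tr (ρ * φ)).re

/-- The pure states of `ℂ^d`, given by unit vectors. -/
abbrev PureState (d : ℕ) : Type := Metric.sphere (0 : EuclideanSpace ℂ (Fin d)) 1

/-- The target state `(|ψ⟩⟨ψ|^T)^{⊗ K}`. -/
def target {d : ℕ} (K : ℕ) (ψ : PureState d) : Op (TensorPow d K) :=
  opPow (transposeOp (ketbra ψ.1 ψ.1)) K

/-- The fidelity `F(C(|ψ⟩⟨ψ|^{⊗ N}), (|ψ⟩⟨ψ|^T)^{⊗ K})` reached by the channel `C` at the pure state
`ψ`; note that `|ψ⟩⟨ψ|^{⊗ N} = |ψ^{⊗ N}⟩⟨ψ^{⊗ N}|`. -/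
def transpositionFidelity {d N K : ℕ} (C : SymChannel d N K) (ψ : PureState d) : ℝ :=
  fidelity (C.app (ketbra (symPow ψ.1 N) (symPow ψ.1 N))) (target K ψ)

/-- The worst-case fidelity of a channel over all pure states. -/
def worstCaseFidelity {d N K : ℕ} (C : SymChannel d N K) : ℝ :=
  ⨅ ψ : PureState d, transpositionFidelity C ψ

/-- The uniform (unitarily invariant) probability measure `dψ` on the unit sphere of `ℂ^d`: the
surface measure, normalised to total mass one. -/
def haarPure (d : ℕ) : Measure (PureState d) :=
  ((volume : Measure (EuclideanSpace ℂ (Fin d))).toSphere Set.univ)⁻¹ •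
    (volume : Measure (EuclideanSpace ℂ (Fin d))).toSphere

/-- The estimation map
`T_CP(ρ) = d_S^N ∫ dψ Tr(ρ |ψ⟩⟨ψ|^{⊗ N}) (|ψ⟩⟨ψ|^T)^{⊗ K}`. -/
def estimationMap (d N K : ℕ) (ρ : Op (symSubspace d N)) : Op (TensorPow d K) :=
  (symDim d N : ℂ) •
    ∫ ψ : PureState d, tr (ρ * ketbra (symPow ψ.1 N) (symPow ψ.1 N)) • target K ψ ∂(haarPure d)

/-- The Choi operator `∑_{i,j} |i⟩⟨j| ⊗ C(|i⟩⟨j|)` on `(ℂ^d)^{⊗ (N+K)}` of a channel `C` on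
`L(sym^N(ℂ^d))`, where `|i⟩⟨j|` is compressed to the symmetric subspace before `C` is applied. -/
def choi {d N K : ℕ} (C : SymChannel d N K) : Op (TensorPow d (N + K)) :=
  ∑ i : Fin N → Fin d, ∑ j : Fin N → Fin d,
    tensorOp (ketbra (ket i) (ket j)) (C.app (compressOp (ketbra (ket i) (ket j))))

end QTranspose

end

open QTranspose

/-! Write J for the Choi operator of a channel and Π for the projector onto sym^{N+K}. The target is
transposed, so input copies and target copies enter the fidelity in the same way: f(ψ) is the
expectation of J in the (N+K)-fold power of the conjugate of ψ (`transpositionFidelity_eq`).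
Averaging over ψ replaces the product states by Π / d_S^{N+K}, hence the mean fidelity is Tr(JΠ) /
d_S^{N+K} (`integral_transpositionFidelity`). Complete positivity gives J ≥ 0 and trace preservation
gives Tr J = d_S^N, so Tr(JΠ) ≤ Tr J, and minimum ≤ mean ≤ d_S^N / d_S^{N+K}.

If the minimum reaches the bound, f is constant by continuity, and Tr(JΠ) = Tr J forces J = ΠJΠ. By
polarization (`symMat_mul_mul_symMat_eq_zero`) an operator compressed to the symmetric subspace is
determined by its expectations in product states, so J is a multiple of Π. A channel is determined
by J, which gives uniqueness.

Conversely, this multiple of Π is the Choi operator of a channel: the columns of Π supply Kraus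
operators, and tracing out the K output factors of Π leaves a multiple of the projector onto sym^N.
Polarization also yields the moment formula itself: unitary invariance makes the expectations of the
averaged state constant on product states. -/

noncomputable section

namespace QTranspose

open Matrix

/-! ### Symmetric tensors and the dimension of the symmetric subspace -/

/-- A coordinate vector of `(ℂ^d)^{⊗ M}` is symmetric if it is invariant under permutations of the
tensor factors. -/
def IsSymVec {d M : ℕ} (v : (Fin M → Fin d) → ℂ) : Prop :=
  ∀ (σ : Equiv.Perm (Fin M)) (i : Fin M → Fin d), v (fun m => i (σ m)) = v i

/-- The coordinates of the product vector `x^{⊗ M}`. -/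
def powVec {d : ℕ} (x : Fin d → ℂ) (M : ℕ) : (Fin M → Fin d) → ℂ := fun i => ∏ m, x (i m)

theorem isSymVec_powVec {d : ℕ} (x : Fin d → ℂ) (M : ℕ) : IsSymVec (powVec x M) :=
  fun σ i => Equiv.prod_comp σ fun m => x (i m)

/-- The exponent vector counting how often each letter occurs in `i`. -/
def letterCount {d M : ℕ} (i : Fin M → Fin d) : Fin d →₀ ℕ := ∑ m, Finsupp.single (i m) 1

theorem letterCount_apply {d M : ℕ} (i : Fin M → Fin d) (a : Fin d) :
    letterCount i a = Fintype.card {m // i m = a} := by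
  simp [letterCount, Finsupp.finsetSum_apply, Finsupp.single_apply, Fintype.card_subtype]

/-- Equal counts give bijections between the fibres over each letter, and these glue to a
permutation of the positions. -/
theorem exists_perm_of_letterCount_eq {d M : ℕ} {i j : Fin M → Fin d}
    (h : letterCount i = letterCount j) : ∃ σ : Equiv.Perm (Fin M), (fun m => j (σ m)) = i := by
  have e : ∀ c, Nonempty ({m // i m = c} ≃ {m // j m = c}) := fun c =>
    ⟨Fintype.equivOfCardEq (by rw [← letterCount_apply, ← letterCount_apply, h])⟩
  refine ⟨Equiv.ofFiberEquiv fun c => (e c).some, ?_⟩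
  ext1 m
  exact Equiv.ofFiberEquiv_map _ m

theorem IsSymVec.eq_of_letterCount_eq {d M : ℕ} {v : (Fin M → Fin d) → ℂ} (hv : IsSymVec v)
    {i j : Fin M → Fin d} (h : letterCount i = letterCount j) : v i = v j := by
  obtain ⟨σ, rfl⟩ := exists_perm_of_letterCount_eq h
  exact hv σ j

/-- The multiset of letters of `i`. -/
def letters {d M : ℕ} (i : Fin M → Fin d) : Sym (Fin d) M :=
  ⟨Finset.univ.val.map i, by simp⟩

theorem letters_comp {d M : ℕ} (i : Fin M → Fin d) (σ : Equiv.Perm (Fin M)) :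
    letters (fun m => i (σ m)) = letters i := by
  apply Subtype.ext
  simpa [letters, Function.comp_def] using Equiv.Perm.ofFn_comp_perm σ i

theorem letterCount_eq_of_letters_eq {d M : ℕ} {i j : Fin M → Fin d}
    (h : letters i = letters j) : letterCount i = letterCount j := by
  ext a
  have h' : (Finset.univ.val.map i).count a = (Finset.univ.val.map j).count a := by
    rw [show Finset.univ.val.map i = Finset.univ.val.map j from congrArg Subtype.val h]
  rw [Multiset.count_map, Multiset.count_map] at h'
  rw [letterCount_apply, letterCount_apply, Fintype.card_subtype, Fintype.card_subtype]
  simpa [Finset.card_def, Finset.filter_val, eq_comm] using h'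

theorem letters_surjective (d M : ℕ) :
    Function.Surjective (letters : (Fin M → Fin d) → Sym (Fin d) M) := by
  rintro ⟨s, hs⟩
  obtain ⟨l, rfl⟩ := Quot.exists_rep s
  have hl : l.length = M := hs
  subst hl
  refine ⟨l.get, Subtype.ext ?_⟩
  simp [letters, Fin.univ_val_map]

/-- Symmetric tensors are the functions of the multiset of letters. -/
def symEquiv (d M : ℕ) : symSubspace d M ≃ₗ[ℂ] (Sym (Fin d) M → ℂ) where
  -- `Function.surjInv` picks some ordering of the multiset; a symmetric tensor does not depend on
  -- the choice.
  toFun v s := v.1 (Function.surjInv (letters_surjective d M) s)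
  map_add' _ _ := rfl
  map_smul' _ _ := rfl
  invFun w := ⟨WithLp.toLp 2 fun i => w (letters i), fun σ i => by
    change w (letters _) = w (letters i)
    rw [letters_comp]⟩
  left_inv v := by
    ext i
    exact IsSymVec.eq_of_letterCount_eq v.2
      (letterCount_eq_of_letters_eq (Function.surjInv_eq (letters_surjective d M) _))
  right_inv w := by
    ext s
    exact congrArg w (Function.surjInv_eq (letters_surjective d M) s)

theorem symDim_eq_choose {d : ℕ} (hd : 1 ≤ d) (M : ℕ) :
    symDim d M = (M + d - 1).choose (d - 1) := by
  rw [symDim, (symEquiv d M).finrank_eq, Module.finrank_fintype_fun_eq_card,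
    Sym.card_sym_eq_choose, Fintype.card_fin, Nat.choose_symm_of_eq_add (b := d - 1) (by omega)]
  congr 1
  omega

theorem symDim_pos {d : ℕ} (hd : 1 ≤ d) (M : ℕ) : 0 < symDim d M := by
  rw [symDim_eq_choose hd]
  exact Nat.choose_pos (by omega)

/-! ### Product vectors and polynomial identities -/

/-- A symmetric vector is determined by the polynomial with these coefficients. -/
theorem IsSymVec.eq_zero_of_dotProduct {d M : ℕ} {v : (Fin M → Fin d) → ℂ} (hv : IsSymVec v)
    (h : ∀ x : Fin d → ℂ, v ⬝ᵥ powVec x M = 0) : v = 0 := by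
  have hP : (∑ i, MvPolynomial.monomial (letterCount i) (v i)) = 0 := by
    apply MvPolynomial.funext
    intro x
    rw [map_zero, map_sum, ← h x]
    refine Finset.sum_congr rfl fun i _ => ?_
    have : (MvPolynomial.monomial (letterCount i) (v i) : MvPolynomial (Fin d) ℂ)
        = MvPolynomial.C (v i) * ∏ m, MvPolynomial.X (i m) := by
      rw [← mul_one (v i), ← MvPolynomial.C_mul_monomial, letterCount,
        MvPolynomial.monomial_sum_one, mul_one]
      rfl
    rw [this]
    simp [powVec]
  ext i
  have hc := congrArg (MvPolynomial.coeff (letterCount i)) hP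
  rw [MvPolynomial.coeff_sum, MvPolynomial.coeff_zero] at hc
  have h1 : ∀ j : Fin M → Fin d,
      MvPolynomial.coeff (letterCount i) (MvPolynomial.monomial (letterCount j) (v j))
        = if letterCount j = letterCount i then v i else 0 := by
    intro j
    rw [MvPolynomial.coeff_monomial]
    split_ifs with hj
    · exact hv.eq_of_letterCount_eq hj
    · rfl
  simp_rw [h1] at hc
  -- The coefficient is `v i` times the number of rearrangements of `i`, which is nonzero since `i`
  -- is one of them.
  rw [← Finset.sum_filter, Finset.sum_const, nsmul_eq_mul, mul_eq_zero] at hc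
  refine hc.resolve_left ?_
  rw [← ne_eq, Nat.cast_ne_zero, Finset.card_ne_zero]
  exact ⟨i, by simp⟩

/-- A Hermitian-type form that vanishes on the diagonal of product vectors vanishes on all pairs
of product vectors. -/
theorem sum_powVec_eq_zero {d M : ℕ} (hd : 1 ≤ d)
    {B : Matrix (Fin M → Fin d) (Fin M → Fin d) ℂ}
    (h : ∀ x : Fin d → ℂ, x ≠ 0 → star (powVec x M) ⬝ᵥ (B *ᵥ powVec x M) = 0)
    (x y : Fin d → ℂ) : powVec x M ⬝ᵥ (B *ᵥ powVec y M) = 0 := by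
  -- With p and q as independent variables, p + iq stands for the vector and p - iq for its
  -- conjugate. The two agree with a genuine conjugate pair only when p and q are real.
  let P : MvPolynomial (Fin d ⊕ Fin d) ℂ := ∑ i : Fin M → Fin d,
    (∏ m, (MvPolynomial.X (Sum.inl (i m))
      - MvPolynomial.C Complex.I * MvPolynomial.X (Sum.inr (i m)))) *
    ∑ j : Fin M → Fin d, MvPolynomial.C (B i j) *
      (∏ m, (MvPolynomial.X (Sum.inl (j m))
        + MvPolynomial.C Complex.I * MvPolynomial.X (Sum.inr (j m))))
  have hev : ∀ z : Fin d ⊕ Fin d → ℂ, MvPolynomial.eval z P =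
      powVec (fun a => z (Sum.inl a) - Complex.I * z (Sum.inr a)) M ⬝ᵥ
        (B *ᵥ powVec (fun a => z (Sum.inl a) + Complex.I * z (Sum.inr a)) M) := by
    intro z
    simp [P, dotProduct, mulVec, powVec, map_sum, map_prod]
  have hP : P = 0 := by
    -- Vanishing on an infinite grid of real points suffices. Taking the coordinates positive keeps
    -- p + iq nonzero, as `h` requires.
    refine MvPolynomial.funext_set (fun _ => Complex.ofReal '' Set.Ioi (0 : ℝ)) (fun _ =>
      (Set.Ioi_infinite (0 : ℝ)).image Complex.ofReal_injective.injOn) fun z hz => ?_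
    choose r hr hrz using fun a => hz a (Set.mem_univ a)
    rw [hev, map_zero, ← h (fun a => z (Sum.inl a) + Complex.I * z (Sum.inr a)) ?_]
    · congr 1
      ext i
      simp only [powVec, Pi.star_apply, RCLike.star_def, map_prod]
      refine Finset.prod_congr rfl fun m _ => ?_
      simp [← hrz, sub_eq_add_neg]
    · intro h0
      have := congrArg Complex.re (congrFun h0 ⟨0, hd⟩)
      simp [← hrz] at this
      exact (hr _).ne' this
  -- These values solve p - iq = x and p + iq = y.
  have := hev (Sum.elim (fun a => (x a + y a) / 2) fun a => (y a - x a) / (2 * Complex.I))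
  rw [hP, map_zero] at this
  rw [this]
  have hI := Complex.I_ne_zero
  congr 2
  · ext a
    simp only [Sum.elim_inl, Sum.elim_inr]
    field_simp
    ring
  · congr 1
    ext a
    simp only [Sum.elim_inl, Sum.elim_inr]
    field_simp
    ring

variable {d M N K : ℕ}

/-! ### Operators and their matrices -/

section Coordinates

variable {ι : Type} [Fintype ι] [DecidableEq ι]

@[simp] theorem mat_ofMat (A : Matrix ι ι ℂ) : mat (ofMat A) = A :=
  (Matrix.toEuclideanCLM (𝕜 := ℂ) (n := ι)).symm_apply_apply A

@[simp] theorem ofMat_mat (A : Op (EuclideanSpace ℂ ι)) : ofMat (mat A) = A :=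
  (Matrix.toEuclideanCLM (𝕜 := ℂ) (n := ι)).apply_symm_apply A

theorem mat_injective : Function.Injective (mat : Op (EuclideanSpace ℂ ι) → Matrix ι ι ℂ) :=
  (Matrix.toEuclideanCLM (𝕜 := ℂ) (n := ι)).symm.injective

@[simp] theorem mat_mul (A B : Op (EuclideanSpace ℂ ι)) : mat (A * B) = mat A * mat B :=
  map_mul (Matrix.toEuclideanCLM (𝕜 := ℂ) (n := ι)).symm A B

@[simp] theorem mat_add (A B : Op (EuclideanSpace ℂ ι)) : mat (A + B) = mat A + mat B :=
  map_add (Matrix.toEuclideanCLM (𝕜 := ℂ) (n := ι)).symm A B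

@[simp] theorem mat_smul (c : ℂ) (A : Op (EuclideanSpace ℂ ι)) : mat (c • A) = c • mat A :=
  map_smul (Matrix.toEuclideanCLM (𝕜 := ℂ) (n := ι)).symm c A

@[simp] theorem mat_one : mat (1 : Op (EuclideanSpace ℂ ι)) = 1 :=
  map_one (Matrix.toEuclideanCLM (𝕜 := ℂ) (n := ι)).symm

@[simp] theorem mat_star (A : Op (EuclideanSpace ℂ ι)) : mat (star A) = (mat A)ᴴ :=
  (Matrix.toEuclideanCLM (𝕜 := ℂ) (n := ι)).symm.map_star' A

@[simp] theorem mat_sum {κ : Type} (s : Finset κ) (A : κ → Op (EuclideanSpace ℂ ι)) :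
    mat (∑ k ∈ s, A k) = ∑ k ∈ s, mat (A k) :=
  map_sum (Matrix.toEuclideanCLM (𝕜 := ℂ) (n := ι)).symm A s

theorem ofLp_apply_eq_mat_mulVec (A : Op (EuclideanSpace ℂ ι)) (v : EuclideanSpace ℂ ι) :
    WithLp.ofLp (A v) = mat A *ᵥ WithLp.ofLp v := by
  conv_lhs => rw [← ofMat_mat A]
  rfl

theorem mat_apply (A : Op (EuclideanSpace ℂ ι)) (i j : ι) : mat A i j = A (ket j) i := by
  rw [ofLp_apply_eq_mat_mulVec]
  simp [ket]

theorem tr_eq_trace_mat (A : Op (EuclideanSpace ℂ ι)) : tr A = (mat A).trace := by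
  have h : (A : EuclideanSpace ℂ ι →ₗ[ℂ] EuclideanSpace ℂ ι)
      = Matrix.toLin (EuclideanSpace.basisFun ι ℂ).toBasis (EuclideanSpace.basisFun ι ℂ).toBasis
        (mat A) := by
    conv_lhs => rw [← ofMat_mat A]
    rfl
  rw [tr, h, LinearMap.trace_eq_matrix_trace ℂ (EuclideanSpace.basisFun ι ℂ).toBasis,
    LinearMap.toMatrix_toLin]

theorem mat_ketbra (v w : EuclideanSpace ℂ ι) :
    mat (ketbra v w) = Matrix.vecMulVec (WithLp.ofLp v) (star (WithLp.ofLp w)) := by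
  ext i j
  rw [mat_apply]
  simp [ketbra, ket, Matrix.vecMulVec_apply, EuclideanSpace.inner_single_right, mul_comm]

end Coordinates

/-! ### The symmetric projector and polarization -/

/-- The matrix of the projector onto the symmetric subspace. -/
def symMat (d M : ℕ) : Matrix (Fin M → Fin d) (Fin M → Fin d) ℂ := mat (symProj d M)

theorem symMat_mul_self (d M : ℕ) : symMat d M * symMat d M = symMat d M := by
  rw [symMat, ← mat_mul]
  exact congrArg mat (symSubspace d M).isIdempotentElem_starProjection

theorem symMat_conjTranspose (d M : ℕ) : (symMat d M)ᴴ = symMat d M := by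
  rw [symMat, ← mat_star]
  exact congrArg mat (isSelfAdjoint_starProjection (symSubspace d M))

theorem isSymVec_symMat_mulVec (v : (Fin M → Fin d) → ℂ) : IsSymVec (symMat d M *ᵥ v) := by
  have h : symProj d M (WithLp.toLp 2 v) ∈ symSubspace d M :=
    (symSubspace d M).starProjection_apply_mem _
  have h2 := ofLp_apply_eq_mat_mulVec (symProj d M) (WithLp.toLp 2 v)
  intro σ i
  rw [symMat, ← h2]
  exact h σ i

theorem IsSymVec.symMat_mulVec {v : (Fin M → Fin d) → ℂ} (hv : IsSymVec v) :
    symMat d M *ᵥ v = v := by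
  have h : symProj d M (WithLp.toLp 2 v) = WithLp.toLp 2 v :=
    Submodule.starProjection_eq_self_iff.mpr hv
  have h2 := ofLp_apply_eq_mat_mulVec (symProj d M) (WithLp.toLp 2 v)
  rw [h] at h2
  exact h2.symm

theorem symMat_mul_of_isSymVec {κ : Type} [Fintype κ] {A : Matrix (Fin M → Fin d) κ ℂ}
    (h : ∀ k, IsSymVec fun i => A i k) : symMat d M * A = A := by
  ext i k
  exact congrFun (h k).symMat_mulVec i

theorem isSymVec_symMat_mul {κ : Type} [Fintype κ] (A : Matrix (Fin M → Fin d) κ ℂ) (k : κ) :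
    IsSymVec fun i => (symMat d M * A) i k :=
  isSymVec_symMat_mulVec fun i => A i k

theorem IsSymVec.star {v : (Fin M → Fin d) → ℂ} (hv : IsSymVec v) : IsSymVec (star v) :=
  fun σ i => congrArg Star.star (hv σ i)

theorem isSymVec_symMat (k : Fin M → Fin d) : IsSymVec fun i => symMat d M i k := by
  have := isSymVec_symMat_mul (symMat d M) k
  rwa [symMat_mul_self] at this

/-- The symmetric subspace is closed under complex conjugation, so the projector and its conjugate
have the same range; both being Hermitian, they coincide. Reality of the projector is what lets rows
and columns, and bilinear and sesquilinear pairings, be treated alike. -/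
theorem symMat_map_star (d M : ℕ) : (symMat d M).map star = symMat d M := by
  have h1 : symMat d M * (symMat d M).map star = (symMat d M).map star :=
    symMat_mul_of_isSymVec fun k => (isSymVec_symMat k).star
  have h2 : ((symMat d M).map star)ᴴ = (symMat d M).map star := by
    conv_rhs => rw [← symMat_conjTranspose]
    ext; simp
  have h3 : (symMat d M).map star * symMat d M = (symMat d M).map star := by
    have := congrArg conjTranspose h1
    rwa [conjTranspose_mul, h2, symMat_conjTranspose] at this
  have h4 : (symMat d M).map star * symMat d M = symMat d M := by
    ext i j
    have h := congrArg star (congrFun (congrFun h1 i) j)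
    simpa [mul_apply] using h
  rw [← h3, h4]

theorem symMat_transpose (d M : ℕ) : (symMat d M)ᵀ = symMat d M := by
  conv_rhs => rw [← symMat_map_star, ← symMat_conjTranspose]
  ext; simp

theorem symMat_comm (i j : Fin M → Fin d) : symMat d M i j = symMat d M j i := by
  conv_lhs => rw [← symMat_transpose]
  rfl

theorem mul_symMat_of_isSymVec {κ : Type} [Fintype κ] {A : Matrix κ (Fin M → Fin d) ℂ}
    (h : ∀ k, IsSymVec (A k)) : A * symMat d M = A := by
  have := congrArg transpose (symMat_mul_of_isSymVec (A := Aᵀ) h)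
  rwa [transpose_mul, symMat_transpose, transpose_transpose] at this

theorem isSymVec_mul_symMat {κ : Type} [Fintype κ] (A : Matrix κ (Fin M → Fin d) ℂ) (k : κ) :
    IsSymVec ((A * symMat d M) k) := by
  have := isSymVec_symMat_mul Aᵀ k
  rw [← symMat_transpose, ← transpose_mul] at this
  exact this

theorem trace_symMat (d M : ℕ) : (symMat d M).trace = symDim d M := by
  rw [symMat, ← tr_eq_trace_mat]
  refine LinearMap.IsProj.trace (p := symSubspace d M) ⟨fun v => ?_, fun v hv => ?_⟩
  · exact (symSubspace d M).starProjection_apply_mem v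
  · exact Submodule.starProjection_eq_self_iff.mpr hv

theorem star_powVec (x : Fin d → ℂ) : star (powVec x M) = powVec (star x) M := by
  ext i
  simp [powVec]

theorem powVec_dotProduct (x y : Fin d → ℂ) : powVec x M ⬝ᵥ powVec y M = (x ⬝ᵥ y) ^ M := by
  simp [powVec, dotProduct, ← Finset.prod_mul_distrib, Fintype.sum_pow]

theorem powVec_smul (c : ℂ) (x : Fin d → ℂ) : powVec (c • x) M = c ^ M • powVec x M := by
  ext i
  simp [powVec, Finset.prod_mul_distrib]

/-- **Polarization.** A form is determined on the symmetric subspace by its diagonal values on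
product vectors. -/
theorem symMat_mul_mul_symMat_eq_zero (hd : 1 ≤ d)
    {B : Matrix (Fin M → Fin d) (Fin M → Fin d) ℂ}
    (h : ∀ ψ : PureState d, star (powVec ψ.1 M) ⬝ᵥ (B *ᵥ powVec ψ.1 M) = 0) :
    symMat d M * B * symMat d M = 0 := by
  have h1 : ∀ x : Fin d → ℂ, x ≠ 0 → star (powVec x M) ⬝ᵥ (B *ᵥ powVec x M) = 0 := by
    intro x hx
    -- The form is homogeneous, so nonzero vectors may be normalised.
    set r : ℂ := (‖(WithLp.toLp 2 x : EuclideanSpace ℂ (Fin d))‖ : ℂ) with hr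
    have hr0 : r ≠ 0 := by simpa [hr] using hx
    have := h ⟨r⁻¹ • WithLp.toLp 2 x, by simp [norm_smul, hr, hx]⟩
    have he : WithLp.ofLp (r⁻¹ • WithLp.toLp 2 x : EuclideanSpace ℂ (Fin d)) = r⁻¹ • x := rfl
    rw [he, powVec_smul, star_smul, mulVec_smul, smul_dotProduct, dotProduct_smul] at this
    simpa [hr0] using this
  have h2 : ∀ x y : Fin d → ℂ,
      powVec x M ⬝ᵥ ((symMat d M * B * symMat d M) *ᵥ powVec y M) = 0 := by
    intro x y
    rw [← mulVec_mulVec, (isSymVec_powVec y M).symMat_mulVec, ← mulVec_mulVec,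
      dotProduct_mulVec, ← mulVec_transpose, symMat_transpose,
      (isSymVec_powVec x M).symMat_mulVec]
    exact sum_powVec_eq_zero hd h1 x y
  -- A symmetric vector that pairs to zero with all product vectors vanishes. This is applied to the
  -- image of each product vector and then to each row.
  have h3 : ∀ y : Fin d → ℂ, (symMat d M * B * symMat d M) *ᵥ powVec y M = 0 := by
    intro y
    refine IsSymVec.eq_zero_of_dotProduct ?_ fun x => ?_
    · rw [mul_assoc, ← mulVec_mulVec]
      exact isSymVec_symMat_mulVec _
    · rw [dotProduct_comm, h2]
  refine funext fun i => ?_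
  exact IsSymVec.eq_zero_of_dotProduct (isSymVec_mul_symMat _ i) fun y => congrFun (h3 y) i

/-! ### The uniform measure on pure states and its moments -/

theorem nontrivial_euclidean (hd : 1 ≤ d) : Nontrivial (EuclideanSpace ℂ (Fin d)) :=
  ⟨⟨ket ⟨0, hd⟩, 0, by simp [ket]⟩⟩

theorem nonempty_pureState (hd : 1 ≤ d) : Nonempty (PureState d) :=
  ⟨⟨ket ⟨0, hd⟩, by simp [ket]⟩⟩

theorem isProbabilityMeasure_haarPure (hd : 1 ≤ d) : IsProbabilityMeasure (haarPure d) := by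
  have := nontrivial_euclidean hd
  have h0 : (volume : Measure (EuclideanSpace ℂ (Fin d))).toSphere Set.univ ≠ 0 :=
    Measure.measure_univ_ne_zero.mpr (Measure.toSphere_ne_zero _)
  refine ⟨?_⟩
  rw [haarPure, Measure.smul_apply, smul_eq_mul]
  exact ENNReal.inv_mul_cancel h0 (measure_ne_top _ _)

/-- Full support upgrades almost everywhere equality of continuous functions to equality, as the
equality case needs. -/
theorem isOpenPosMeasure_haarPure : (haarPure d).IsOpenPosMeasure := by
  have : (volume : Measure (EuclideanSpace ℂ (Fin d))).toSphere.IsOpenPosMeasure :=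
    inferInstance
  refine ⟨fun U hU hne => ?_⟩
  rw [haarPure, Measure.smul_apply, smul_eq_mul]
  exact mul_ne_zero (ENNReal.inv_ne_zero.mpr (measure_ne_top _ _)) (hU.measure_ne_zero _ hne)

/-- The action of an isometry on unit vectors. -/
def sphereMap (f : EuclideanSpace ℂ (Fin d) ≃ₗᵢ[ℝ] EuclideanSpace ℂ (Fin d)) :
    PureState d ≃ₜ PureState d where
  toFun ψ := ⟨f ψ.1, by simp⟩
  invFun ψ := ⟨f.symm ψ.1, by simp⟩
  left_inv ψ := by simp
  right_inv ψ := by simp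
  continuous_toFun := by fun_prop
  continuous_invFun := by fun_prop

/-- Surface measure is proportional to the volume of the cone over a set. A linear isometry commutes
with forming cones and preserves volume. -/
theorem measurePreserving_sphereMap
    (f : EuclideanSpace ℂ (Fin d) ≃ₗᵢ[ℝ] EuclideanSpace ℂ (Fin d)) :
    MeasurePreserving (sphereMap f) (haarPure d) (haarPure d) := by
  refine ⟨(sphereMap f).measurable, ?_⟩
  rw [haarPure, Measure.map_smul]
  congr 1
  ext s hs
  rw [Measure.map_apply (sphereMap f).measurable hs, Measure.toSphere_apply' _ hs,
    Measure.toSphere_apply' _ ((sphereMap f).measurable hs)]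
  congr 1
  refine Eq.trans ?_ (f.measurePreserving.measure_preimage_equiv (f := f.toMeasurableEquiv) _)
  congr 1
  ext v
  simp only [Set.mem_smul, Set.mem_image, Set.mem_preimage]
  constructor
  · rintro ⟨r, hr, _, ⟨ψ, hψ, rfl⟩, rfl⟩
    exact ⟨r, hr, _, ⟨sphereMap f ψ, hψ, rfl⟩, (map_smul f r ψ.1).symm⟩
  · rintro ⟨r, hr, _, ⟨ψ, hψ, rfl⟩, h⟩
    refine ⟨r, hr, _, ⟨(sphereMap f).symm ψ, by simpa using hψ, rfl⟩, ?_⟩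
    apply f.injective
    rw [map_smul]
    change r • f (f.symm ψ.1) = _
    rw [f.apply_symm_apply]
    exact h

theorem integral_sphereMap {G : Type} [NormedAddCommGroup G] [NormedSpace ℝ G]
    (f : EuclideanSpace ℂ (Fin d) ≃ₗᵢ[ℝ] EuclideanSpace ℂ (Fin d)) (g : PureState d → G) :
    ∫ ψ, g (sphereMap f ψ) ∂(haarPure d) = ∫ ψ, g ψ ∂(haarPure d) :=
  (measurePreserving_sphereMap f).integral_comp (sphereMap f).measurableEmbedding g

/-- The unitary group acts transitively on unit vectors. -/
theorem exists_linearIsometryEquiv_apply_eq (φ χ : PureState d) :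
    ∃ f : EuclideanSpace ℂ (Fin d) ≃ₗᵢ[ℂ] EuclideanSpace ℂ (Fin d), f φ.1 = χ.1 := by
  have key : ∀ φ : PureState d, ∃ (b : OrthonormalBasis (Fin d) ℂ (EuclideanSpace ℂ (Fin d)))
      (i : Fin d), i.1 = 0 ∧ b i = φ.1 := by
    intro φ
    have hd : 0 < d := by
      rcases Nat.eq_zero_or_pos d with rfl | h
      · have := φ.2
        simp [Subsingleton.elim φ.1 0] at this
      · exact h
    let v : Fin d → EuclideanSpace ℂ (Fin d) := fun _ => φ.1
    have hv : Orthonormal ℂ (Set.domRestrict {(⟨0, hd⟩ : Fin d)} v) := by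
      constructor
      · intro i
        exact mem_sphere_zero_iff_norm.mp φ.2
      · intro i j hij
        exact absurd (Subsingleton.elim i j) hij
    obtain ⟨b, hb⟩ := hv.exists_orthonormalBasis_extension_of_card_eq (by simp)
    exact ⟨b, ⟨0, hd⟩, rfl, hb _ rfl⟩
  obtain ⟨b, i, hi, hb⟩ := key φ
  obtain ⟨c, j, hj, hc⟩ := key χ
  have hij : i = j := Fin.ext (hi.trans hj.symm)
  subst hij
  exact ⟨b.equiv c (Equiv.refl _), by rw [← hb, ← hc]; simp⟩

theorem continuous_powVec_apply (i : Fin M → Fin d) :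
    Continuous fun ψ : PureState d => powVec ψ.1 M i := by
  unfold powVec
  fun_prop

theorem integrable_of_continuous (hd : 1 ≤ d) {G : Type} [NormedAddCommGroup G]
    {g : PureState d → G} (hg : Continuous g) : Integrable g (haarPure d) := by
  have := isProbabilityMeasure_haarPure hd
  exact hg.integrable_of_hasCompactSupport (HasCompactSupport.of_compactSpace g)

theorem star_dotProduct_eq_inner (x y : EuclideanSpace ℂ (Fin d)) :
    star (WithLp.ofLp x) ⬝ᵥ WithLp.ofLp y = inner ℂ x y := by
  rw [EuclideanSpace.inner_eq_star_dotProduct, dotProduct_comm]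

theorem star_powVec_dotProduct_self (ψ : PureState d) :
    star (powVec ψ.1 M) ⬝ᵥ powVec ψ.1 M = 1 := by
  rw [star_powVec, powVec_dotProduct, star_dotProduct_eq_inner, inner_self_eq_norm_sq_to_K]
  simp

theorem sum_powVec_mul_star (ψ : PureState d) :
    ∑ x, powVec ψ.1 M x * star (powVec ψ.1 M x) = 1 := by
  rw [← star_powVec_dotProduct_self (M := M) ψ, dotProduct_comm]
  rfl

/-- The moments of the uniform measure on pure states: `∫ |ψ⟩⟨ψ|^{⊗ M} dψ = Π_sym / d_S^M`. -/
theorem integral_powVec_mul_star (hd : 1 ≤ d) (x y : Fin M → Fin d) :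
    ∫ ψ : PureState d, powVec ψ.1 M x * star (powVec ψ.1 M y) ∂(haarPure d)
      = (symDim d M : ℂ)⁻¹ * symMat d M x y := by
  have := isProbabilityMeasure_haarPure hd
  have hint : ∀ x y : Fin M → Fin d, Integrable
      (fun ψ : PureState d => powVec ψ.1 M x * star (powVec ψ.1 M y)) (haarPure d) := fun x y =>
    integrable_of_continuous hd ((continuous_powVec_apply x).mul (continuous_powVec_apply y).star)
  let A : Matrix (Fin M → Fin d) (Fin M → Fin d) ℂ := Matrix.of fun x y =>
    ∫ ψ : PureState d, powVec ψ.1 M x * star (powVec ψ.1 M y) ∂(haarPure d)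
  have hA1 : ∀ k, IsSymVec fun i => A i k := fun k σ i => by
    simp only [A, of_apply]
    simp_rw [isSymVec_powVec _ M σ i]
  have hA2 : ∀ k, IsSymVec (A k) := fun k σ i => by
    simp only [A, of_apply]
    simp_rw [isSymVec_powVec _ M σ i]
  -- The diagonal values of the averaged state are averages of |⟨φ, ψ⟩|^{2M}.
  have hquad : ∀ φ : PureState d, star (powVec φ.1 M) ⬝ᵥ (A *ᵥ powVec φ.1 M)
      = ∫ ψ : PureState d, inner ℂ φ.1 ψ.1 ^ M * star (inner ℂ φ.1 ψ.1 ^ M) ∂(haarPure d) := by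
    intro φ
    have h1 : ∀ ψ : PureState d, inner ℂ φ.1 ψ.1 ^ M * star (inner ℂ φ.1 ψ.1 ^ M)
        = ∑ x, ∑ y, (star (powVec φ.1 M x) * powVec φ.1 M y) *
          (powVec ψ.1 M x * star (powVec ψ.1 M y)) := by
      intro ψ
      have h2 : inner ℂ φ.1 ψ.1 ^ M = star (powVec φ.1 M) ⬝ᵥ powVec ψ.1 M := by
        rw [star_powVec, powVec_dotProduct, star_dotProduct_eq_inner]
      rw [h2, dotProduct, star_sum, Finset.sum_mul_sum]
      refine Finset.sum_congr rfl fun x _ => Finset.sum_congr rfl fun y _ => ?_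
      simp only [Pi.star_apply, star_mul', star_star]
      ring
    simp_rw [h1]
    rw [integral_finsetSum _ fun x _ => integrable_finsetSum _ fun y _ => (hint x y).const_mul _]
    simp only [dotProduct, mulVec, Finset.mul_sum]
    refine Finset.sum_congr rfl fun x _ => ?_
    rw [integral_finsetSum _ fun y _ => (hint x y).const_mul _]
    refine Finset.sum_congr rfl fun y _ => ?_
    rw [integral_const_mul]
    simp only [A, of_apply, Pi.star_apply]
    ring
  obtain ⟨χ⟩ := nonempty_pureState hd
  set κ := star (powVec χ.1 M) ⬝ᵥ (A *ᵥ powVec χ.1 M) with hκ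
  -- A unitary taking φ to χ, substituted in the integral, turns one average into the other.
  have hconst : ∀ φ : PureState d, star (powVec φ.1 M) ⬝ᵥ (A *ᵥ powVec φ.1 M) = κ := by
    intro φ
    obtain ⟨f, hf⟩ := exists_linearIsometryEquiv_apply_eq φ χ
    let fr : EuclideanSpace ℂ (Fin d) ≃ₗᵢ[ℝ] EuclideanSpace ℂ (Fin d) :=
      { f.toLinearEquiv.restrictScalars ℝ with norm_map' := f.norm_map }
    rw [hκ, hquad, hquad, ← integral_sphereMap fr fun ψ =>
      inner ℂ χ.1 ψ.1 ^ M * star (inner ℂ χ.1 ψ.1 ^ M)]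
    congr 1
    ext ψ
    have : inner ℂ χ.1 (sphereMap fr ψ).1 = inner ℂ φ.1 ψ.1 := by
      rw [← hf]
      exact f.inner_map_map _ _
    rw [this]
  -- By polarization `A` agrees with a multiple of the projector on the symmetric subspace. It lives
  -- there, since its rows and columns are symmetric; the trace then fixes the factor.
  have hzero := symMat_mul_mul_symMat_eq_zero hd (B := A - κ • symMat d M) fun φ => by
    rw [sub_mulVec, smul_mulVec, (isSymVec_powVec _ M).symMat_mulVec, dotProduct_sub,
      dotProduct_smul, star_powVec_dotProduct_self, hconst]
    simp
  have hAκ : A = κ • symMat d M := by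
    rw [mul_sub, sub_mul, symMat_mul_of_isSymVec hA1, mul_symMat_of_isSymVec hA2] at hzero
    simpa [symMat_mul_self, sub_eq_zero] using hzero
  have htr : A.trace = 1 := by
    simp only [trace, diag_apply, A, of_apply]
    rw [← integral_finsetSum _ fun x _ => hint x x]
    simp only [sum_powVec_mul_star, integral_const, probReal_univ, one_smul]
  rw [hAκ, trace_smul, trace_symMat, smul_eq_mul] at htr
  rw [← eq_inv_of_mul_eq_one_left htr]
  exact congrFun (congrFun hAκ x) y

/-! ### Complete positivity and block matrices -/

section CompletePositivity

theorem exists_eq_star_mul_self_of_nonneg {A : Type} [NonUnitalCStarAlgebra A] [PartialOrder A]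
    [StarOrderedRing A] {a : A} (ha : 0 ≤ a) : ∃ b, a = star b * b :=
  CStarAlgebra.nonneg_iff_eq_star_mul_self.mp ha

theorem mul_ketbra {H : Type} [NormedAddCommGroup H] [InnerProductSpace ℂ H] (A : Op H)
    (u v : H) : A * ketbra u v = ketbra (A u) v := by
  ext w
  simp [ketbra]

variable {H₁ H₂ : Type} [NormedAddCommGroup H₁] [InnerProductSpace ℂ H₁] [CompleteSpace H₁]
  [NormedAddCommGroup H₂] [InnerProductSpace ℂ H₂] [CompleteSpace H₂]
  {n : Type} [Fintype n]

theorem star_ketbra (u v : H₁) : star (ketbra u v) = ketbra v u :=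
  InnerProductSpace.adjoint_rankOne u v

theorem ketbra_mul (A : Op H₁) (u v : H₁) : ketbra u v * A = ketbra u (star A v) := by
  rw [← star_star (ketbra u v * A), star_mul, star_ketbra, mul_ketbra, star_ketbra]

/-- The block matrix `|u_i⟩⟨u_j|` is positive. -/
theorem ketbra_cstarMatrix_nonneg (f : H₁) (hf : ‖f‖ = 1) (u : n → H₁) :
    0 ≤ (CStarMatrix.ofMatrix (Matrix.of fun i j => ketbra (u i) (u j)) :
      CStarMatrix n n (Op H₁)) := by
  classical
  rcases isEmpty_or_nonempty n with h | ⟨⟨i₀⟩⟩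
  · exact le_of_eq (by ext i; exact h.elim i)
  -- Only row `i₀` is nonzero, with entries |f⟩⟨u_j|; as f is a unit vector, it contracts away in
  -- `star X * X`.
  let X : CStarMatrix n n (Op H₁) :=
    CStarMatrix.ofMatrix (Matrix.of fun a j => if a = i₀ then ketbra f (u j) else 0)
  have hX : CStarMatrix.ofMatrix (Matrix.of fun i j => ketbra (u i) (u j)) = star X * X := by
    ext1 i j
    have : (star X * X) i j = ∑ a, star (X a i) * X a j := rfl
    rw [this, Finset.sum_eq_single i₀]
    · simp only [X, CStarMatrix.ofMatrix_apply, of_apply, if_true, star_ketbra, mul_ketbra]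
      congr 1
      simp [ketbra, hf]
    · intro a _ ha
      simp [X, ha]
    · simp
  rw [hX]
  exact star_mul_self_nonneg X

/-- A resolution of the identity is inserted between the factors. This breaks the entries of a
positive block matrix into rank-one operators, on which a Kraus form acts termwise. -/
theorem star_mul_eq_sum_ketbra {κ : Type} [Fintype κ] (b : OrthonormalBasis κ ℂ H₁)
    (A B : Op H₁) : star A * B = ∑ e, ketbra (star A (b e)) (star B (b e)) := by
  have h : (1 : Op H₁) = ∑ e, ketbra (b e) (b e) := by
    ext w
    simp [ketbra, b.sum_repr']
  calc star A * B = star A * 1 * B := by rw [mul_one]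
    _ = _ := by simp_rw [h, Finset.mul_sum, Finset.sum_mul, mul_ketbra, ketbra_mul]

/-- A map with a Kraus decomposition is completely positive. -/
theorem map_cstarMatrix_nonneg_of_kraus [FiniteDimensional ℂ H₁] {κ : Type} [Fintype κ]
    (φ : Op H₁ →ₗ[ℂ] Op H₂) (g : κ → H₁ → H₂) (f : H₂) (hf : ‖f‖ = 1)
    (hφ : ∀ u v, φ (ketbra u v) = ∑ l, ketbra (g l u) (g l v))
    (M : CStarMatrix n n (Op H₁)) (hM : 0 ≤ M) : 0 ≤ M.map φ := by
  obtain ⟨X, rfl⟩ := exists_eq_star_mul_self_of_nonneg hM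
  let b := stdOrthonormalBasis ℂ H₁
  have h : (star X * X).map φ = ∑ a, ∑ e, ∑ l, CStarMatrix.ofMatrix (Matrix.of fun i j =>
      ketbra (g l (star (X a i) (b e))) (g l (star (X a j) (b e)))) := by
    ext1 i j
    have h1 : (star X * X) i j = ∑ a, star (X a i) * X a j := rfl
    have h2 : ((star X * X).map φ) i j = φ ((star X * X) i j) := rfl
    rw [h2, h1, map_sum]
    simp_rw [star_mul_eq_sum_ketbra b, map_sum, hφ]
    have h3 : ∀ {τ : Type} (s : Finset τ) (F : τ → CStarMatrix n n (Op H₂)),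
        (∑ t ∈ s, F t) i j = ∑ t ∈ s, F t i j := by
      intro τ s F
      exact Matrix.sum_apply i j s F
    simp_rw [h3]
    rfl
  rw [h]
  exact Finset.sum_nonneg fun a _ => Finset.sum_nonneg fun e _ => Finset.sum_nonneg fun l _ =>
    ketbra_cstarMatrix_nonneg f hf _

open scoped ComplexOrder in
/-- A positive block matrix of operators on `ℂ^ι` is positive semidefinite. -/
theorem posSemidef_of_cstarMatrix_nonneg {ι : Type} [Fintype ι] [DecidableEq ι]
    {G : CStarMatrix n n (Op (EuclideanSpace ℂ ι))} (hG : 0 ≤ G) :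
    (Matrix.of fun x y : n × ι => mat (G x.1 y.1) x.2 y.2).PosSemidef := by
  obtain ⟨Y, rfl⟩ := exists_eq_star_mul_self_of_nonneg hG
  let W : Matrix (n × ι) (n × ι) ℂ := Matrix.of fun k x => mat (Y k.1 x.1) k.2 x.2
  have h : (Matrix.of fun x y : n × ι => mat ((star Y * Y) x.1 y.1) x.2 y.2) = Wᴴ * W := by
    ext x y
    have h1 : (star Y * Y) x.1 y.1 = ∑ a, star (Y a x.1) * Y a y.1 := rfl
    rw [of_apply, h1, mat_sum, Matrix.sum_apply, mul_apply, Fintype.sum_prod_type]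
    refine Finset.sum_congr rfl fun a _ => ?_
    rw [mat_mul, mat_star, mul_apply]
    rfl
  rw [h]
  exact posSemidef_conjTranspose_mul_self W

end CompletePositivity

/-! ### Splitting N + K tensor factors -/

theorem append_split (x : Fin (N + K) → Fin d) :
    Fin.append (fun n => x (Fin.castAdd K n)) (fun k => x (Fin.natAdd N k)) = x :=
  Fin.append_castAdd_natAdd

theorem sum_append {G : Type} [AddCommMonoid G] (F : (Fin (N + K) → Fin d) → G) :
    ∑ x, F x = ∑ i : Fin N → Fin d, ∑ a : Fin K → Fin d, F (Fin.append i a) := by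
  rw [← Fintype.sum_prod_type', ← (Fin.appendEquiv N K).sum_comp]
  rfl

theorem powVec_append (x : Fin d → ℂ) (i : Fin N → Fin d) (a : Fin K → Fin d) :
    powVec x (N + K) (Fin.append i a) = powVec x N i * powVec x K a := by
  simp [powVec, Fin.prod_univ_add]

theorem IsSymVec.append {v : (Fin (N + K) → Fin d) → ℂ} (hv : IsSymVec v)
    (a : Fin K → Fin d) : IsSymVec fun i : Fin N → Fin d => v (Fin.append i a) := by
  intro σ i
  beta_reduce
  -- A permutation of the first N positions is extended by the identity on the last K.
  rw [← hv (finSumFinEquiv.permCongr (Equiv.sumCongr σ (Equiv.refl _))) (Fin.append i a)]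
  congr 1
  ext m
  refine Fin.addCases (fun n => ?_) (fun k => ?_) m <;> simp [Equiv.permCongr_apply]

/-- `(Π_sym^{(N)} ⊗ 1) Π_sym^{(N+K)} = Π_sym^{(N+K)}` in coordinates. -/
theorem sum_symMat_mul_symMat_append (i : Fin N → Fin d) (a : Fin K → Fin d)
    (y : Fin (N + K) → Fin d) :
    ∑ j, symMat d N i j * symMat d (N + K) (Fin.append j a) y
      = symMat d (N + K) (Fin.append i a) y :=
  congrFun ((isSymVec_symMat y).append a).symMat_mulVec i

/-- The partial trace of the symmetric projector, in coordinates. -/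
theorem sum_symMat_append_append (hd : 1 ≤ d) (i j : Fin N → Fin d) :
    ∑ a : Fin K → Fin d, symMat d (N + K) (Fin.append i a) (Fin.append j a)
      = (symDim d (N + K) : ℂ) / symDim d N * symMat d N i j := by
  have hN : (symDim d N : ℂ) ≠ 0 := Nat.cast_ne_zero.mpr (symDim_pos hd N).ne'
  have hNK : (symDim d (N + K) : ℂ) ≠ 0 := Nat.cast_ne_zero.mpr (symDim_pos hd (N + K)).ne'
  -- Under the moment integral the product vector factorises, and the sum over the last K factors is
  -- the squared norm, equal to 1.
  have h : ∀ a : Fin K → Fin d, symMat d (N + K) (Fin.append i a) (Fin.append j a)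
      = symDim d (N + K) * ∫ ψ : PureState d, powVec ψ.1 (N + K) (Fin.append i a) *
        star (powVec ψ.1 (N + K) (Fin.append j a)) ∂(haarPure d) := by
    intro a
    rw [integral_powVec_mul_star hd, mul_inv_cancel_left₀ hNK]
  simp_rw [h]
  have hint : ∀ a : Fin K → Fin d, Integrable (fun ψ : PureState d =>
      powVec ψ.1 (N + K) (Fin.append i a) * star (powVec ψ.1 (N + K) (Fin.append j a)))
      (haarPure d) := fun a => integrable_of_continuous hd
    ((continuous_powVec_apply _).mul (continuous_powVec_apply _).star)
  rw [← Finset.mul_sum, ← integral_finsetSum _ fun a _ => hint a, div_mul_eq_mul_div,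
    mul_div_assoc, div_eq_inv_mul, ← integral_powVec_mul_star hd]
  congr 2
  ext ψ
  calc _ = powVec ψ.1 N i * star (powVec ψ.1 N j) *
        ∑ a, powVec ψ.1 K a * star (powVec ψ.1 K a) := by
        rw [Finset.mul_sum]
        refine Finset.sum_congr rfl fun a _ => ?_
        rw [powVec_append, powVec_append, star_mul']
        ring
    _ = _ := by rw [sum_powVec_mul_star, mul_one]

/-! ### Extension from and compression to the symmetric subspace -/

theorem extendOp_ketbra (u v : symSubspace d M) :
    extendOp (ketbra u v) = ketbra u.1 v.1 := by
  ext1 w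
  have h : inner ℂ v ((symSubspace d M).orthogonalProjectionOnto w) = inner ℂ v.1 w :=
    Submodule.inner_orthogonalProjectionOnto_eq_of_mem_left v w
  simp only [extendOp, ketbra, ContinuousLinearMap.comp_apply, InnerProductSpace.rankOne_apply, h,
    map_smul, Submodule.subtypeL_apply]

theorem compressOp_extendOp (ρ : Op (symSubspace d M)) : compressOp (extendOp ρ) = ρ := by
  ext1 w
  simp [compressOp, extendOp]

theorem extendOp_compressOp (A : Op (TensorPow d M)) :
    extendOp (compressOp A) = symProj d M * A * symProj d M := by
  rfl

theorem symProj_mul_extendOp (ρ : Op (symSubspace d M)) :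
    symProj d M * extendOp ρ = extendOp ρ := by
  ext1 w
  exact Submodule.starProjection_eq_self_iff.mpr (Subtype.mem _)

theorem tr_extendOp (ρ : Op (symSubspace d M)) : tr (extendOp ρ) = tr ρ := by
  have h := LinearMap.trace_comp_comm' (R := ℂ)
    ((symSubspace d M).orthogonalProjectionOnto.toLinearMap)
    ((symSubspace d M).subtypeL.toLinearMap ∘ₗ ρ.toLinearMap)
  refine Eq.trans h ?_
  unfold tr
  congr 1
  ext1 w
  simp

theorem tr_compressOp (A : Op (TensorPow d M)) :
    tr (compressOp A) = (symMat d M * mat A).trace := by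
  rw [← tr_extendOp, extendOp_compressOp, tr_eq_trace_mat, mat_mul, mat_mul, trace_mul_comm,
    ← mul_assoc]
  exact congrArg (fun B => trace (B * mat A)) (symMat_mul_self d M)

theorem eq_sum_ketbra (A : Op (TensorPow d M)) :
    A = ∑ i, ∑ j, mat A i j • ketbra (ket i) (ket j) := by
  apply mat_injective
  ext x y
  simp [Matrix.sum_apply, mat_ketbra, ket, vecMulVec_apply, Pi.single_apply]

theorem compressOp_ketbra (u v : TensorPow d M) :
    compressOp (ketbra u v) = ketbra ((symSubspace d M).orthogonalProjectionOnto u)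
      ((symSubspace d M).orthogonalProjectionOnto v) := by
  ext1 w
  simp [compressOp, ketbra]

/-- The compressed matrix units span the operators on the symmetric subspace; hence the Choi
operator determines the channel. -/
theorem eq_sum_compressOp (ρ : Op (symSubspace d M)) :
    ρ = ∑ i, ∑ j, mat (extendOp ρ) i j • compressOp (ketbra (ket i) (ket j)) := by
  conv_lhs => rw [← compressOp_extendOp ρ, eq_sum_ketbra (extendOp ρ)]
  ext1 w
  simp [compressOp]

theorem mat_tensorOp (A : Op (TensorPow d N)) (B : Op (TensorPow d K))
    (i j : Fin N → Fin d) (a b : Fin K → Fin d) :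
    mat (tensorOp A B) (Fin.append i a) (Fin.append j b) = mat A i j * mat B a b := by
  simp [tensorOp]

theorem mat_transposeOp {ι : Type} [Fintype ι] [DecidableEq ι] (A : Op (EuclideanSpace ℂ ι)) :
    mat (transposeOp A) = (mat A)ᵀ :=
  mat_ofMat _

theorem mat_partialTraceFirst (A : Op (TensorPow d (N + K))) (a b : Fin K → Fin d) :
    mat (partialTraceFirst A) a b
      = ∑ i : Fin N → Fin d, mat A (Fin.append i a) (Fin.append i b) := by
  rw [partialTraceFirst, mat_ofMat, of_apply]

/-! ### The optimal channel -/

/-- The optimal value `d_S^N / d_S^{N+K}`. -/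
def optFidelity (d N K : ℕ) : ℝ := (symDim d N : ℝ) / (symDim d (N + K) : ℝ)

theorem optFidelity_nonneg (d N K : ℕ) : 0 ≤ optFidelity d N K := by
  unfold optFidelity
  positivity

/-- The transpose turns the partial trace into an entrywise pairing with ρ, the form in which a Choi
operator acts on a state (`SymChannel.mat_app`). -/
theorem mat_partialTraceFirst_symProj (ρ : Op (TensorPow d N)) (a b : Fin K → Fin d) :
    mat (partialTraceFirst
      (symProj d (N + K) * tensorOp (transposeOp ρ) (1 : Op (TensorPow d K)))) a b
      = ∑ i, ∑ j, symMat d (N + K) (Fin.append i a) (Fin.append j b) * mat ρ i j := by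
  rw [mat_partialTraceFirst]
  refine Finset.sum_congr rfl fun i _ => ?_
  rw [mat_mul, mul_apply, sum_append]
  refine Finset.sum_congr rfl fun j _ => ?_
  simp only [mat_tensorOp, mat_transposeOp, mat_one, one_apply, transpose_apply]
  simp [symMat]

/-- The map `ρ ↦ (d_S^N / d_S^{N+K}) Tr_{1…N}[Π_sym (ρ^T ⊗ 1)]`. -/
def optimalMap (d N K : ℕ) : Op (symSubspace d N) →ₗ[ℂ] Op (TensorPow d K) where
  toFun ρ := ((symDim d N : ℂ) / (symDim d (N + K) : ℂ)) • partialTraceFirst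
    (symProj d (N + K) * tensorOp (transposeOp (extendOp ρ)) (1 : Op (TensorPow d K)))
  map_add' ρ σ := by
    apply mat_injective
    have h : extendOp (ρ + σ) = extendOp ρ + extendOp σ := by
      ext1 w
      simp [extendOp]
    ext a b
    rw [← smul_add]
    simp only [mat_smul, mat_add, Matrix.smul_apply, Matrix.add_apply,
      mat_partialTraceFirst_symProj, h, mul_add, Finset.sum_add_distrib]
  map_smul' c ρ := by
    apply mat_injective
    have h : extendOp (c • ρ) = c • extendOp ρ := by
      ext1 w
      simp [extendOp]
    ext a b
    simp only [mat_smul, Matrix.smul_apply, mat_partialTraceFirst_symProj, h, smul_eq_mul,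
      RingHom.id_apply, Finset.mul_sum]
    refine Finset.sum_congr rfl fun i _ => Finset.sum_congr rfl fun j _ => ?_
    ring

theorem mat_optimalMap (ρ : Op (symSubspace d N)) (a b : Fin K → Fin d) :
    mat (optimalMap d N K ρ) a b = (symDim d N : ℂ) / (symDim d (N + K) : ℂ) *
      ∑ i, ∑ j, symMat d (N + K) (Fin.append i a) (Fin.append j b) * mat (extendOp ρ) i j := by
  rw [← mat_partialTraceFirst_symProj, ← smul_eq_mul, ← Matrix.smul_apply, ← mat_smul]
  rfl

/-- Tracing out the K outputs leaves a multiple of the projector onto sym^N, whose factor the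
normalisation cancels; that projector acts as the identity on the extension of ρ. -/
theorem tr_optimalMap (hd : 1 ≤ d) (ρ : Op (symSubspace d N)) :
    tr (optimalMap d N K ρ) = tr ρ := by
  have hN : (symDim d N : ℂ) ≠ 0 := Nat.cast_ne_zero.mpr (symDim_pos hd N).ne'
  have hNK : (symDim d (N + K) : ℂ) ≠ 0 := Nat.cast_ne_zero.mpr (symDim_pos hd (N + K)).ne'
  rw [tr_eq_trace_mat, trace]
  simp only [diag_apply, mat_optimalMap]
  rw [← Finset.mul_sum, Finset.sum_comm]
  have h : ∀ i : Fin N → Fin d, ∑ a : Fin K → Fin d, ∑ j,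
      symMat d (N + K) (Fin.append i a) (Fin.append j a) * mat (extendOp ρ) i j
      = (symDim d (N + K) : ℂ) / symDim d N * ∑ j, symMat d N i j * mat (extendOp ρ) i j := by
    intro i
    rw [Finset.sum_comm, Finset.mul_sum]
    refine Finset.sum_congr rfl fun j _ => ?_
    rw [← Finset.sum_mul, sum_symMat_append_append hd, mul_assoc]
  simp_rw [h]
  rw [← Finset.mul_sum, ← mul_assoc, div_mul_div_cancel₀ hNK, div_self hN, one_mul,
    ← tr_extendOp, tr_eq_trace_mat]
  conv_rhs => rw [← symProj_mul_extendOp, mat_mul, trace_mul_comm]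
  simp only [trace, diag_apply, mul_apply]
  refine Finset.sum_congr rfl fun i _ => Finset.sum_congr rfl fun j _ => ?_
  rw [mul_comm, symMat_comm]
  rfl

/-- The Kraus operators of the optimal map. -/
def krausMap (d N K : ℕ) (l : Fin (N + K) → Fin d) (u : symSubspace d N) : TensorPow d K :=
  WithLp.toLp 2 fun a => (Real.sqrt (optFidelity d N K) : ℂ) *
    ∑ i, symMat d (N + K) (Fin.append i a) l * u.1 i

/-- The projector equals itself times its adjoint, so each of its columns, read as a map from N
factors to K factors, is a Kraus operator up to the scalar. -/
theorem optimalMap_ketbra (u v : symSubspace d N) :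
    optimalMap d N K (ketbra u v) = ∑ l, ketbra (krausMap d N K l u) (krausMap d N K l v) := by
  apply mat_injective
  ext a b
  have hc : (symDim d N : ℂ) / (symDim d (N + K) : ℂ)
      = (Real.sqrt (optFidelity d N K) : ℂ) * (Real.sqrt (optFidelity d N K) : ℂ) := by
    rw [← Complex.ofReal_mul, Real.mul_self_sqrt (optFidelity_nonneg d N K)]
    simp [optFidelity]
  have hS : ∀ i j : Fin N → Fin d, symMat d (N + K) (Fin.append i a) (Fin.append j b)
      = ∑ l, symMat d (N + K) (Fin.append i a) l * star (symMat d (N + K) (Fin.append j b) l) := by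
    intro i j
    conv_lhs => rw [← symMat_mul_self]
    rw [mul_apply]
    refine Finset.sum_congr rfl fun l _ => ?_
    rw [← conjTranspose_apply, symMat_conjTranspose]
  rw [mat_optimalMap, mat_sum, Matrix.sum_apply, extendOp_ketbra, hc]
  simp only [mat_ketbra, vecMulVec_apply, krausMap, Pi.star_apply, hS, star_mul', star_sum,
    Finset.mul_sum, Finset.sum_mul]
  refine Finset.sum_comm.trans (Eq.trans ?_ Finset.sum_comm)
  refine Finset.sum_congr rfl fun j _ => Finset.sum_comm.trans ?_
  refine Finset.sum_congr rfl fun l _ => Finset.sum_congr rfl fun i _ => ?_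
  simp only [RCLike.star_def, Complex.conj_ofReal]
  ring

/-- The optimal channel. -/
def optimalChannel (d N K : ℕ) (hd : 1 ≤ d) : SymChannel d N K where
  toLinearMap := optimalMap d N K
  map_cstarMatrix_nonneg' k M hM := map_cstarMatrix_nonneg_of_kraus (optimalMap d N K)
    (krausMap d N K) (ket fun _ => ⟨0, hd⟩) (by simp [ket]) optimalMap_ketbra M hM
  trace_preserving := tr_optimalMap hd

/-! ### The optimal channel as an estimation channel -/

theorem mat_target (ψ : PureState d) (a b : Fin K → Fin d) :
    mat (target K ψ) a b = powVec ψ.1 K b * star (powVec ψ.1 K a) := by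
  rw [target, opPow, mat_ofMat, of_apply]
  simp only [mat_transposeOp, transpose_apply, mat_ketbra, vecMulVec_apply, Pi.star_apply,
    Finset.prod_mul_distrib, powVec]
  simp

theorem tr_mul_ketbra_symPow (ρ : Op (symSubspace d N)) (ψ : PureState d) :
    tr (ρ * ketbra (symPow ψ.1 N) (symPow ψ.1 N))
      = ∑ i, ∑ j, mat (extendOp ρ) i j * (powVec ψ.1 N j * star (powVec ψ.1 N i)) := by
  have h : extendOp (ρ * ketbra (symPow ψ.1 N) (symPow ψ.1 N))
      = extendOp ρ * ketbra (vecPow ψ.1 N) (vecPow ψ.1 N) := by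
    rw [show vecPow ψ.1 N = (symPow ψ.1 N).1 from rfl, ← extendOp_ketbra]
    ext1 w
    simp [extendOp]
  rw [← tr_extendOp, h, tr_eq_trace_mat, mat_mul, mat_ketbra]
  rfl

theorem mat_integral {F : PureState d → Op (TensorPow d K)}
    (hF : Integrable F (haarPure d)) (a b : Fin K → Fin d) :
    mat (∫ ψ, F ψ ∂(haarPure d)) a b = ∫ ψ, mat (F ψ) a b ∂(haarPure d) := by
  let L : Op (TensorPow d K) →L[ℂ] ℂ := LinearMap.toContinuousLinearMap
    { toFun := fun A => mat A a b
      map_add' := fun A B => by simp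
      map_smul' := fun c A => by simp }
  exact (L.integral_comp_comm hF).symm

theorem continuous_of_mat {X ι : Type} [TopologicalSpace X] [Fintype ι] [DecidableEq ι]
    {F : X → Op (EuclideanSpace ℂ ι)} (h : ∀ a b, Continuous fun x => mat (F x) a b) :
    Continuous F := by
  let L : Matrix ι ι ℂ →ₗ[ℂ] Op (EuclideanSpace ℂ ι) :=
    (Matrix.toEuclideanCLM (𝕜 := ℂ) (n := ι)).toAlgEquiv.toLinearMap
  have hL : Continuous L := L.continuous_of_finiteDimensional
  have h2 : Continuous fun x => mat (F x) := continuous_matrix h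
  have h3 := hL.comp h2
  convert h3 using 1
  ext1 x
  exact (ofMat_mat (F x)).symm

/-- The trace factor and the transposed target merge into entries of |ψ⟩⟨ψ|^{⊗(N+K)}, whose mean is
the normalised projector. -/
theorem optimalMap_eq_estimationMap (hd : 1 ≤ d) (ρ : Op (symSubspace d N)) :
    optimalMap d N K ρ = estimationMap d N K ρ := by
  apply mat_injective
  ext a b
  have hent : ∀ (ψ : PureState d) (a b : Fin K → Fin d),
      mat (tr (ρ * ketbra (symPow ψ.1 N) (symPow ψ.1 N)) • target K ψ) a b
      = ∑ i, ∑ j, mat (extendOp ρ) i j * (powVec ψ.1 (N + K) (Fin.append j b)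
        * star (powVec ψ.1 (N + K) (Fin.append i a))) := by
    intro ψ a b
    rw [mat_smul, Matrix.smul_apply, mat_target, tr_mul_ketbra_symPow, smul_eq_mul]
    simp only [Finset.sum_mul, powVec_append, star_mul']
    refine Finset.sum_congr rfl fun i _ => Finset.sum_congr rfl fun j _ => ?_
    ring
  have hcont : ∀ i j : Fin N → Fin d, ∀ a b : Fin K → Fin d, Continuous fun ψ : PureState d =>
      mat (extendOp ρ) i j * (powVec ψ.1 (N + K) (Fin.append j b)
        * star (powVec ψ.1 (N + K) (Fin.append i a))) := fun i j a b =>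
    continuous_const.mul ((continuous_powVec_apply _).mul (continuous_powVec_apply _).star)
  have hint : Integrable (fun ψ : PureState d =>
      tr (ρ * ketbra (symPow ψ.1 N) (symPow ψ.1 N)) • target K ψ) (haarPure d) := by
    refine integrable_of_continuous hd (continuous_of_mat fun a b => ?_)
    simp_rw [hent]
    exact continuous_finsetSum _ fun i _ => continuous_finsetSum _ fun j _ => hcont i j a b
  rw [estimationMap, mat_smul, Matrix.smul_apply, mat_integral hint, mat_optimalMap]
  simp_rw [hent]
  rw [integral_finsetSum _ fun i _ => integrable_finsetSum _ fun j _ =>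
    integrable_of_continuous hd (hcont i j a b), div_eq_mul_inv, mul_assoc, smul_eq_mul]
  congr 1
  rw [Finset.mul_sum]
  refine Finset.sum_congr rfl fun i _ => ?_
  rw [integral_finsetSum _ fun j _ => integrable_of_continuous hd (hcont i j a b),
    Finset.mul_sum]
  refine Finset.sum_congr rfl fun j _ => ?_
  rw [integral_const_mul, integral_powVec_mul_star hd, symMat_comm]
  ring

/-! ### The Choi operator and the fidelity -/

theorem mat_choi (C : SymChannel d N K) (i j : Fin N → Fin d) (a b : Fin K → Fin d) :
    mat (choi C) (Fin.append i a) (Fin.append j b)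
      = mat (C.app (compressOp (ketbra (ket i) (ket j)))) a b := by
  rw [choi, mat_sum, Matrix.sum_apply, Finset.sum_eq_single i, mat_sum, Matrix.sum_apply,
    Finset.sum_eq_single j]
  · simp [mat_tensorOp, mat_ketbra, vecMulVec_apply, ket]
  · intro j' _ hj
    simp [mat_tensorOp, mat_ketbra, vecMulVec_apply, ket, hj.symm]
  · simp
  · intro i' _ hi
    simp [mat_sum, Matrix.sum_apply, mat_tensorOp, mat_ketbra, vecMulVec_apply, ket, hi.symm]
  · simp

theorem SymChannel.app_sum_smul (C : SymChannel d N K) {κ : Type} (s : Finset κ) (c : κ → ℂ)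
    (A : κ → Op (symSubspace d N)) : C.app (∑ k ∈ s, c k • A k) = ∑ k ∈ s, c k • C.app (A k) := by
  have h := map_sum C.toLinearMap (fun k => c k • A k) s
  simp only [map_smul] at h
  exact h

theorem SymChannel.app_sum (C : SymChannel d N K) {κ : Type} (s : Finset κ)
    (A : κ → Op (symSubspace d N)) : C.app (∑ k ∈ s, A k) = ∑ k ∈ s, C.app (A k) :=
  map_sum C.toLinearMap A s

theorem SymChannel.mat_app (C : SymChannel d N K) (ρ : Op (symSubspace d N))
    (a b : Fin K → Fin d) : mat (C.app ρ) a b =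
      ∑ i, ∑ j, mat (extendOp ρ) i j * mat (choi C) (Fin.append i a) (Fin.append j b) := by
  conv_lhs => rw [eq_sum_compressOp ρ, C.app_sum]
  simp only [C.app_sum_smul, mat_sum, Matrix.sum_apply, mat_smul, Matrix.smul_apply, smul_eq_mul,
    mat_choi]

theorem SymChannel.ext_of_choi {C T : SymChannel d N K} (h : choi C = choi T) : C = T := by
  have happ : ∀ ρ, C.app ρ = T.app ρ := by
    intro ρ
    apply mat_injective
    ext a b
    rw [C.mat_app, T.mat_app, h]
  rcases C with ⟨⟨C, hC⟩, hC'⟩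
  rcases T with ⟨⟨T, hT⟩, hT'⟩
  have : C = T := LinearMap.ext happ
  subst this
  rfl

/-- Transposing the target aligns its indices with those of the input, so both combine into one
product vector on N + K factors. -/
theorem transpositionFidelity_eq (C : SymChannel d N K) (ψ : PureState d) :
    transpositionFidelity C ψ = (∑ x, ∑ y, mat (choi C) x y *
      (powVec ψ.1 (N + K) x * star (powVec ψ.1 (N + K) y))).re := by
  rw [transpositionFidelity, fidelity, tr_eq_trace_mat, mat_mul, trace]
  congr 1
  have hρ : mat (extendOp (ketbra (symPow ψ.1 N) (symPow ψ.1 N)))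
      = vecMulVec (powVec ψ.1 N) (star (powVec ψ.1 N)) := by
    rw [extendOp_ketbra, mat_ketbra]
    rfl
  simp only [diag_apply, mul_apply, C.mat_app, mat_target, hρ, vecMulVec_apply, sum_append,
    powVec_append, Finset.sum_mul, star_mul', Pi.star_apply]
  have hL : ∀ F : (Fin K → Fin d) → (Fin K → Fin d) → (Fin N → Fin d) → (Fin N → Fin d) → ℂ,
      ∑ a, ∑ b, ∑ i, ∑ j, F a b i j = ∑ i, ∑ a, ∑ j, ∑ b, F a b i j := by
    intro F
    calc _ = ∑ a, ∑ i, ∑ b, ∑ j, F a b i j := Finset.sum_congr rfl fun a _ => Finset.sum_comm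
      _ = ∑ i, ∑ a, ∑ b, ∑ j, F a b i j := Finset.sum_comm
      _ = _ := Finset.sum_congr rfl fun i _ => Finset.sum_congr rfl fun a _ => Finset.sum_comm
  rw [hL]
  refine Finset.sum_congr rfl fun i _ => Finset.sum_congr rfl fun a _ =>
    Finset.sum_congr rfl fun j _ => Finset.sum_congr rfl fun b _ => ?_
  ring

theorem continuous_transpositionFidelity (C : SymChannel d N K) :
    Continuous (transpositionFidelity C) := by
  rw [show transpositionFidelity C = _ from funext (transpositionFidelity_eq C)]
  exact Complex.continuous_re.comp (continuous_finsetSum _ fun x _ => continuous_finsetSum _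
    fun y _ => continuous_const.mul
      ((continuous_powVec_apply _).mul (continuous_powVec_apply _).star))

theorem isLeast_worstCaseFidelity (hd : 1 ≤ d) (C : SymChannel d N K) :
    IsLeast (Set.range (transpositionFidelity C)) (worstCaseFidelity C) := by
  have := nonempty_pureState hd
  have hc := isCompact_range (continuous_transpositionFidelity C)
  exact hc.isLeast_sInf (Set.range_nonempty _)

theorem worstCaseFidelity_le (hd : 1 ≤ d) (C : SymChannel d N K) (ψ : PureState d) :
    worstCaseFidelity C ≤ transpositionFidelity C ψ :=
  (isLeast_worstCaseFidelity hd C).2 ⟨ψ, rfl⟩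

/-- The average fidelity is `Tr(J Π_sym) / d_S^{N+K}` for the Choi operator `J`. -/
theorem integral_transpositionFidelity (hd : 1 ≤ d) (C : SymChannel d N K) :
    ∫ ψ, transpositionFidelity C ψ ∂(haarPure d)
      = (mat (choi C) * symMat d (N + K)).trace.re / symDim d (N + K) := by
  have hint : ∀ x y : Fin (N + K) → Fin d, Integrable (fun ψ : PureState d =>
      mat (choi C) x y * (powVec ψ.1 (N + K) x * star (powVec ψ.1 (N + K) y))) (haarPure d) :=
    fun x y => integrable_of_continuous hd (continuous_const.mul
      ((continuous_powVec_apply _).mul (continuous_powVec_apply _).star))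
  simp_rw [transpositionFidelity_eq]
  have h := integral_re (𝕜 := ℂ) (integrable_finsetSum Finset.univ fun x _ =>
    integrable_finsetSum Finset.univ fun y _ => hint x y)
  refine h.trans ?_
  rw [integral_finsetSum _ fun x _ => integrable_finsetSum _ fun y _ => hint x y,
    ← Complex.div_natCast_re, RCLike.re_eq_complex_re]
  congr 1
  rw [trace, Finset.sum_div]
  refine Finset.sum_congr rfl fun x _ => ?_
  rw [integral_finsetSum _ fun y _ => hint x y, diag_apply, mul_apply, Finset.sum_div]
  refine Finset.sum_congr rfl fun y _ => ?_
  rw [integral_const_mul, integral_powVec_mul_star hd, symMat_comm]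
  ring

open scoped ComplexOrder in
-- The Choi operator is the blockwise image of the positive block matrix formed from the projected
-- basis vectors.
theorem posSemidef_choi (hd : 1 ≤ d) (C : SymChannel d N K) : (mat (choi C)).PosSemidef := by
  -- A unit vector of sym^N, required to write that block matrix as a square.
  have hf : ‖symPow (ket ⟨0, hd⟩ : EuclideanSpace ℂ (Fin d)) N‖ = 1 := by
    have h := star_powVec_dotProduct_self (M := N) (⟨ket ⟨0, hd⟩, by simp [ket]⟩ : PureState d)
    have h2 : inner ℂ (vecPow (ket ⟨0, hd⟩ : EuclideanSpace ℂ (Fin d)) N)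
        (vecPow (ket ⟨0, hd⟩) N) = 1 := by
      rw [EuclideanSpace.inner_eq_star_dotProduct, dotProduct_comm]
      exact h
    have h3 : ‖vecPow (ket ⟨0, hd⟩ : EuclideanSpace ℂ (Fin d)) N‖ ^ 2 = 1 := by
      rw [← inner_self_eq_norm_sq (𝕜 := ℂ), h2, RCLike.one_re]
    exact (pow_eq_one_iff_of_nonneg (norm_nonneg _) two_ne_zero).mp h3
  have h0 := ketbra_cstarMatrix_nonneg _ hf
    fun i : Fin N → Fin d => (symSubspace d N).orthogonalProjectionOnto (ket i)
  have h1 := C.toCompletelyPositiveMap.map_cstarMatrix_nonneg _ h0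
  have h2 := (posSemidef_of_cstarMatrix_nonneg h1).submatrix (Fin.appendEquiv N K).symm
  convert h2 using 1
  ext x y
  rw [← append_split x, ← append_split y, mat_choi, compressOp_ketbra]
  simp only [submatrix_apply, of_apply]
  have he : ∀ (i : Fin N → Fin d) (a : Fin K → Fin d),
      (Fin.appendEquiv N K).symm (Fin.append i a) = (i, a) := fun i a =>
    (Fin.appendEquiv N K).symm_apply_apply (i, a)
  rw [he, he]
  rfl

/-- By trace preservation, block (i, i) has trace ⟨i|Π|i⟩ with Π the projector onto sym^N; these sum
to its rank. -/
theorem trace_choi (C : SymChannel d N K) : (mat (choi C)).trace = symDim d N := by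
  have h : ∀ i : Fin N → Fin d, ∑ a : Fin K → Fin d,
      mat (choi C) (Fin.append i a) (Fin.append i a) = symMat d N i i := by
    intro i
    have h1 : tr (C.app (compressOp (ketbra (ket i) (ket i))))
        = tr (compressOp (ketbra (ket i) (ket i))) := C.trace_preserving _
    rw [tr_compressOp, tr_eq_trace_mat, mat_ketbra] at h1
    simp only [mat_choi]
    refine h1.trans ?_
    rw [trace_mul_comm, vecMulVec_mul, trace_vecMulVec]
    simp [ket]
  rw [trace]
  simp only [diag_apply]
  rw [sum_append]
  simp_rw [h]
  exact trace_symMat d N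

/-- Compressing the matrix units puts the projector onto sym^N on both sides of the projector onto
sym^{N+K}, which absorbs it. -/
theorem choi_optimalChannel (hd : 1 ≤ d) : choi (optimalChannel d N K hd)
    = ((symDim d N : ℂ) / (symDim d (N + K) : ℂ)) • symProj d (N + K) := by
  apply mat_injective
  ext x y
  rw [← append_split x, ← append_split y]
  generalize (fun n => x (Fin.castAdd K n)) = i
  generalize (fun n => y (Fin.castAdd K n)) = j
  generalize (fun k => x (Fin.natAdd N k)) = a
  generalize (fun k => y (Fin.natAdd N k)) = b
  rw [mat_choi]
  refine (mat_optimalMap _ a b).trans ?_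
  rw [mat_smul, Matrix.smul_apply, smul_eq_mul]
  congr 1
  have hE : ∀ i' j', mat (extendOp (compressOp (ketbra (ket i) (ket j) : Op (TensorPow d N))))
      i' j' = symMat d N i i' * symMat d N j j' := by
    intro i' j'
    rw [extendOp_compressOp, mat_mul, mat_mul, mat_ketbra, mul_vecMulVec, vecMulVec_mul,
      vecMulVec_apply]
    change (symMat d N *ᵥ _) i' * (_ ᵥ* symMat d N) j' = _
    simp [ket, symMat_comm i i']
  simp only [hE]
  have h1 : ∀ i', ∑ j', symMat d (N + K) (Fin.append i' a) (Fin.append j' b) *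
      (symMat d N i i' * symMat d N j j')
      = symMat d N i i' * symMat d (N + K) (Fin.append i' a) (Fin.append j b) := by
    intro i'
    rw [symMat_comm (Fin.append i' a), ← sum_symMat_mul_symMat_append j, Finset.mul_sum]
    refine Finset.sum_congr rfl fun j' _ => ?_
    rw [symMat_comm (Fin.append i' a)]
    ring
  simp_rw [h1]
  exact sum_symMat_mul_symMat_append i a _

theorem transpositionFidelity_of_choi (C : SymChannel d N K)
    (h : choi C = ((symDim d N : ℂ) / (symDim d (N + K) : ℂ)) • symProj d (N + K))
    (ψ : PureState d) : transpositionFidelity C ψ = optFidelity d N K := by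
  rw [transpositionFidelity_eq, h]
  have h1 : ∑ x, ∑ y, mat (((symDim d N : ℂ) / (symDim d (N + K) : ℂ)) • symProj d (N + K)) x y *
      (powVec ψ.1 (N + K) x * star (powVec ψ.1 (N + K) y))
      = (symDim d N : ℂ) / (symDim d (N + K) : ℂ) *
        ∑ x, powVec ψ.1 (N + K) x * (symMat d (N + K) *ᵥ star (powVec ψ.1 (N + K))) x := by
    simp only [mulVec, dotProduct, Finset.mul_sum, mat_smul, Matrix.smul_apply, smul_eq_mul]
    refine Finset.sum_congr rfl fun x _ => Finset.sum_congr rfl fun y _ => ?_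
    simp only [symMat, Pi.star_apply]
    ring
  rw [h1, (isSymVec_powVec _ _).star.symMat_mulVec]
  simp only [Pi.star_apply]
  rw [sum_powVec_mul_star, mul_one, optFidelity, ← Complex.ofReal_natCast,
    ← Complex.ofReal_natCast, ← Complex.ofReal_div, Complex.ofReal_re]

/-! ### The upper bound and the equality case -/

open scoped ComplexOrder in
/-- The part of a positive semidefinite matrix outside the symmetric subspace. -/
theorem posSemidef_compl {B : Matrix (Fin M → Fin d) (Fin M → Fin d) ℂ} (hB : B.PosSemidef) :
    (((1 - symMat d M)ᴴ) * B * (1 - symMat d M)).PosSemidef :=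
  hB.conjTranspose_mul_mul_same _

theorem trace_compl (B : Matrix (Fin M → Fin d) (Fin M → Fin d) ℂ) :
    (((1 - symMat d M)ᴴ) * B * (1 - symMat d M)).trace = B.trace - (B * symMat d M).trace := by
  have h : (1 - symMat d M)ᴴ = 1 - symMat d M := by
    rw [conjTranspose_sub, conjTranspose_one, symMat_conjTranspose]
  have h2 : (1 - symMat d M) * (1 - symMat d M) = 1 - symMat d M := by
    simp [mul_sub, sub_mul, symMat_mul_self]
  rw [h, trace_mul_comm, ← mul_assoc, h2, trace_mul_comm, mul_sub, mul_one, trace_sub]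

open scoped ComplexOrder in
-- The compression of `B` to the orthogonal complement is positive with trace zero, hence zero. A
-- positive matrix annihilates every vector on which its form vanishes, so `B` kills the complement.
theorem mul_symMat_of_trace_eq {B : Matrix (Fin M → Fin d) (Fin M → Fin d) ℂ}
    (hB : B.PosSemidef) (h : (B * symMat d M).trace = B.trace) :
    symMat d M * B * symMat d M = B := by
  have h0 : ((1 - symMat d M)ᴴ) * B * (1 - symMat d M) = 0 := by
    rw [← (posSemidef_compl hB).trace_eq_zero_iff, trace_compl, h, sub_self]
  have h1 : B * (1 - symMat d M) = 0 := by
    refine Matrix.ext_of_mulVec_single fun y => ?_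
    rw [← mulVec_mulVec, zero_mulVec, ← hB.dotProduct_mulVec_zero_iff, star_mulVec,
      ← dotProduct_mulVec, mulVec_mulVec, mulVec_mulVec, h0, zero_mulVec,
      dotProduct_zero]
  have h2 : B * symMat d M = B := by
    rw [mul_sub, mul_one, sub_eq_zero] at h1
    exact h1.symm
  have h3 := congrArg conjTranspose h2
  rw [conjTranspose_mul, symMat_conjTranspose, hB.isHermitian.eq] at h3
  rw [h3, h2]

open scoped ComplexOrder in
theorem re_trace_choi_mul_symMat_le (hd : 1 ≤ d) (C : SymChannel d N K) :
    (mat (choi C) * symMat d (N + K)).trace.re ≤ symDim d N := by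
  have h := (posSemidef_compl (posSemidef_choi hd C)).trace_nonneg
  rw [trace_compl, trace_choi] at h
  have := (Complex.le_def.mp h).1
  simpa using this

theorem integral_transpositionFidelity_le (hd : 1 ≤ d) (C : SymChannel d N K) :
    ∫ ψ, transpositionFidelity C ψ ∂(haarPure d) ≤ optFidelity d N K := by
  rw [integral_transpositionFidelity hd, optFidelity]
  gcongr
  exact re_trace_choi_mul_symMat_le hd C

theorem integrable_transpositionFidelity (hd : 1 ≤ d) (C : SymChannel d N K) :
    Integrable (transpositionFidelity C) (haarPure d) :=
  integrable_of_continuous hd (continuous_transpositionFidelity C)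

theorem worstCaseFidelity_le_optFidelity (hd : 1 ≤ d) (C : SymChannel d N K) :
    worstCaseFidelity C ≤ optFidelity d N K := by
  have := isProbabilityMeasure_haarPure hd
  refine le_trans ?_ (integral_transpositionFidelity_le hd C)
  have h := integral_mono (integrable_const (worstCaseFidelity C))
    (integrable_transpositionFidelity hd C) (worstCaseFidelity_le hd C)
  simpa using h

open scoped ComplexOrder in
theorem choi_of_worstCaseFidelity_eq (hd : 1 ≤ d) (C : SymChannel d N K)
    (h : worstCaseFidelity C = optFidelity d N K) :
    choi C = ((symDim d N : ℂ) / (symDim d (N + K) : ℂ)) • symProj d (N + K) := by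
  have := isProbabilityMeasure_haarPure hd
  have := isOpenPosMeasure_haarPure (d := d)
  have hpos : (0 : ℝ) < symDim d (N + K) := Nat.cast_pos.mpr (symDim_pos hd _)
  have hle : ∀ ψ, optFidelity d N K ≤ transpositionFidelity C ψ := fun ψ =>
    h ▸ worstCaseFidelity_le hd C ψ
  have hint := integrable_transpositionFidelity hd C
  have hI : ∫ ψ, transpositionFidelity C ψ ∂(haarPure d) = optFidelity d N K := by
    refine le_antisymm (integral_transpositionFidelity_le hd C) ?_
    have := integral_mono (integrable_const (optFidelity d N K)) hint hle
    simpa using this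
  -- A continuous function that is bounded below by its mean is constant, by full support of the
  -- measure.
  have hconst : ∀ ψ, transpositionFidelity C ψ = optFidelity d N K := by
    have h0 : ∫ ψ, (transpositionFidelity C ψ - optFidelity d N K) ∂(haarPure d) = 0 := by
      rw [integral_sub hint (integrable_const _), hI]
      simp
    rw [integral_eq_zero_iff_of_nonneg (fun ψ => sub_nonneg.mpr (hle ψ))
      (hint.sub (integrable_const _))] at h0
    have h1 := (((continuous_transpositionFidelity C).sub continuous_const).ae_eq_iff_eq
      (haarPure d) continuous_const).mp h0
    intro ψ
    exact sub_eq_zero.mp (congrFun h1 ψ)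
  have hps := posSemidef_choi hd C
  have hJ := mul_symMat_of_trace_eq hps (by
    have h1 : (((1 - symMat d (N + K))ᴴ) * mat (choi C) * (1 - symMat d (N + K))).trace = 0 := by
      have hnn := (posSemidef_compl hps).trace_nonneg
      -- The mean fidelity controls only the real part of the trace; positivity makes the imaginary
      -- part vanish.
      have him := (Complex.le_def.mp hnn).2
      refine Complex.ext ?_ him.symm
      rw [trace_compl, trace_choi, Complex.sub_re, Complex.zero_re, Complex.natCast_re,
        sub_eq_zero]
      rw [integral_transpositionFidelity hd, optFidelity,
        div_left_inj' hpos.ne'] at hI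
      exact hI.symm
    rw [trace_compl, sub_eq_zero] at h1
    exact h1.symm)
  set c : ℂ := (symDim d N : ℂ) / (symDim d (N + K) : ℂ) with hc
  have hcr : c = (optFidelity d N K : ℂ) := by simp [hc, optFidelity]
  -- The fidelity at ψ evaluates the Choi operator on the conjugate of ψ, so polarization at ψ uses
  -- the fidelity at the conjugate state.
  let conjEquiv : PureState d → PureState d := fun ψ =>
    ⟨WithLp.toLp 2 (star (WithLp.ofLp ψ.1)), by
      rw [mem_sphere_zero_iff_norm]
      refine Eq.trans ?_ (mem_sphere_zero_iff_norm.mp ψ.2)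
      rw [EuclideanSpace.norm_eq, EuclideanSpace.norm_eq]
      simp⟩
  have hzero := symMat_mul_mul_symMat_eq_zero hd
    (B := mat (choi C) - c • symMat d (N + K)) fun ψ => by
    rw [sub_mulVec, smul_mulVec, (isSymVec_powVec _ _).symMat_mulVec, dotProduct_sub,
      dotProduct_smul, star_powVec_dotProduct_self, sub_eq_zero, smul_eq_mul, mul_one, hcr,
      ← hconst (conjEquiv ψ), transpositionFidelity_eq]
    have hq : star (powVec ψ.1 (N + K)) ⬝ᵥ mat (choi C) *ᵥ powVec ψ.1 (N + K)
        = ∑ x, ∑ y, mat (choi C) x y * (powVec (conjEquiv ψ).1 (N + K) x *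
          star (powVec (conjEquiv ψ).1 (N + K) y)) := by
      have hcp : powVec (conjEquiv ψ).1 (N + K) = star (powVec ψ.1 (N + K)) :=
        (star_powVec _).symm
      rw [hcp]
      simp only [dotProduct, mulVec, Finset.mul_sum, Pi.star_apply, star_star]
      refine Finset.sum_congr rfl fun x _ => Finset.sum_congr rfl fun y _ => ?_
      ring
    -- The fidelity is a real part by definition; positivity shows that the form itself is real.
    have hnn := hps.dotProduct_mulVec_nonneg (powVec ψ.1 (N + K))
    rw [← hq]
    exact Complex.ext rfl (Complex.le_def.mp hnn).2.symm
  apply mat_injective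
  rw [mul_sub, sub_mul, hJ, mul_smul_comm, smul_mul_assoc, symMat_mul_self, symMat_mul_self,
    sub_eq_zero] at hzero
  rw [hzero, mat_smul]
  rfl

theorem worstCaseFidelity_of_const (hd : 1 ≤ d) (C : SymChannel d N K) {r : ℝ}
    (h : ∀ ψ, transpositionFidelity C ψ = r) : worstCaseFidelity C = r := by
  obtain ⟨ψ, hψ⟩ := (isLeast_worstCaseFidelity hd C).1
  rw [← hψ, h]

end QTranspose

end

open QTranspose
theorem mainTheorem4 (d N K : ℕ) (hd : 1 ≤ d) :
    (∀ M : ℕ, symDim d M = (M + d - 1).choose (d - 1)) ∧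
    (∀ C : SymChannel d N K,
      IsLeast (Set.range (transpositionFidelity C)) (worstCaseFidelity C)) ∧
    IsGreatest (Set.range fun C : SymChannel d N K => worstCaseFidelity C)
      ((symDim d N : ℝ) / (symDim d (N + K) : ℝ)) ∧
    ∃ T : SymChannel d N K,
      (∀ ρ : Op (symSubspace d N), T.app ρ = estimationMap d N K ρ) ∧
      (∀ ρ : Op (symSubspace d N),
        T.app ρ = ((symDim d N : ℂ) / (symDim d (N + K) : ℂ)) •
          partialTraceFirst
            (symProj d (N + K) * tensorOp (transposeOp (extendOp ρ)) (1 : Op (TensorPow d K)))) ∧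
      (∀ C : SymChannel d N K,
        worstCaseFidelity C = (symDim d N : ℝ) / (symDim d (N + K) : ℝ) ↔ C = T) ∧
      (∀ ψ : PureState d,
        transpositionFidelity T ψ = (symDim d N : ℝ) / (symDim d (N + K) : ℝ)) ∧
      choi T = ((symDim d N : ℂ) / (symDim d (N + K) : ℂ)) • symProj d (N + K) := by
  have hchoi := choi_optimalChannel (N := N) (K := K) hd
  have hT := transpositionFidelity_of_choi _ hchoi
  have hworst := worstCaseFidelity_of_const hd _ hT
  refine ⟨symDim_eq_choose hd, isLeast_worstCaseFidelity hd, ⟨⟨_, hworst⟩, ?_⟩,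
    optimalChannel d N K hd, optimalMap_eq_estimationMap hd, fun _ => rfl,
    fun C => ⟨fun h => ?_, ?_⟩, hT, hchoi⟩
  · rintro _ ⟨C, rfl⟩
    exact worstCaseFidelity_le_optFidelity hd C
  · exact SymChannel.ext_of_choi ((choi_of_worstCaseFidelity_eq hd C h).trans hchoi.symm)
  · rintro rfl
    exact hworst
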